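/- **Setting.** Let $G$ be a finite simple graph. Its vertices are servers and its edges are files; each file is stored exactly on the two servers that are its endpoints. The files $W_e$ are independent and uniform in $\mathbb F_2^L$. A retrieval scheme $T$ for $G$ lets the user draw private randomness independent of the files and, for a desired file $\theta$, compute from it queries $Q_v(\theta)$ to the servers $v$; server $v$ returns an answer $A_v(\theta)$ that is a function of $Q_v(\theta)$ and of the collection $\mathcal W_v$ of files stored on $v$. Query and answer alphabets are finite. $T$ is a *PIR scheme* if it is *reliable*, i.e. $H\big(W_\theta\mid (A_v(\theta))_v,(Q_v(\theta))_v\big)=0$ for all $\theta$, and *private*, i.e. for each server $v$ the joint distribution of $(Q_v(\theta),A_v(\theta),\mathcal W_v)$ does not depend on $\theta$. Its rate is $L/\sum_v H(A_v(\theta))$ (entropy in bits; for a private scheme it does not depend on $\theta$), and the PIR capacity $\mathscr C(G)$ is the supremum of the rates of all PIR schemes for $G$, over all $L\ge 1$. **The scheme for $K_N$.** Let $N\ge 3$, let the servers be $[N]=\{1,\dots,N\}$, write $N(j)=[N]\setminus\{j\}$, let $W_{j,\ell}=W_{\ell,j}$ be the file on servers $j$ and $\ell$, and let $L=3\cdot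 2^{N-2}$. The user draws independent uniform permutations $\pi_{j,\ell}=\pi_{\ell,j}$ of $[L]$, one for each file, and puts $w_{j,\ell}(t)=W_{j,\ell}(\pi_{j,\ell}(t))$. Let $W_{i,i'}$ be the desired file, its two servers being taken in some order $(i,i')$. Put $M=[N]\setminus\{i,i'\}$, $\mathcal F=\{P\subseteq[N]:|P\cap\{i,i'\}|=1\}$, and let $\mathcal G$ be the set of the $2^{N-3}$ unordered pairs $\{P_1,P_2\}$ of disjoint (possibly empty) sets with $P_1\cup P_2=M$. Fix bijections $\phi:\mathcal F\to[2^{N-1}]$ and $\varphi:\mathcal G\to[2^{N-1}+1:2^{N-1}+2^{N-3}]$. For $P\subseteq M$ write $\varphi_P=\varphi(\{P,M\setminus P\})$. For each server $j$ define $\sigma_j$ on the nonempty $P\subseteq N(j)$ by - $\sigma_i(P)=\phi(\{i\}\cup(P\setminus\{i'\}))$ if $i'\in P$, and $\sigma_i(P)=\varphi_P+2^{N-3}$ if $i'\notin P$; - $\sigma_{i'}(P)=\phi(\{i'\}\cup(P\setminus\{i\}))$ if $i\in P$, and $\sigma_{i'}(P)=\varphi_P$ if $i\notin P$; - for $j\ne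 i,i'$: $\sigma_j(P)=\phi(P\cup\{j\})$ if $P\in\mathcal F$; $\sigma_j(P)=\varphi_{\{j\}\cup(P\setminus\{i,i'\})}$ if $\{i,i'\}\subseteq P$; and to the remaining $P$ (those containing neither $i$ nor $i'$) one assigns arbitrary distinct elements of $[2^{N-1}]$ that $\sigma_j$ does not take on $\mathcal F$. From each server $j$ the user downloads the bits $$D^j_P=\sum_{\ell\in P}w_{j,\ell}(\sigma_j(P))\qquad(\emptyset\ne P\subseteq N(j)),$$ and, for each $g\in\mathcal G$ (listed in the order of $\varphi(g)$), the bit $$D^i_g=\sum_{\ell\in N(i)}w_{i,\ell}(\varphi(g))\ \text{ if } j=i,\qquad D^j_g=\sum_{\ell\in N(j)}w_{j,\ell}(\varphi(g)+2^{N-3})\ \text{ if } j\neq i.$$ The query to server $j$ lists, for each of these sums, the position $\pi_{j,\ell}(\cdot)$ of the requested bit in each of the files $W_{j,\ell}$ that occur in it. **Theorem.** Let $N\ge 3$. For each desired file, choices of the order $(i,i')$, of $\phi$, of $\varphi$ and of the arbitrary assignments as above exist. For every family of such choices (one for each desired file), the scheme above is a PIR scheme for $K_N$, and its rate is $$R=\frac{3\cdot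 2^{N-2}}{2^{N-1}+2^{N-3}-1}\cdot\frac1N=\frac{6}{5-2^{3-N}}\cdot\frac1N .$$ For $N=3$ this equals the PIR capacity: $R=\mathscr C(K_3)=\tfrac12$. For $N\ge 4$ it exceeds the rate $\frac{2^{N-1}}{2^{N-1}-1}\cdot\frac1N$ of the earlier general scheme, and for $N=4$ it also exceeds the earlier rate $\frac3{10}$. -/

import Mathlib

noncomputable section

namespace GraphPIR

/-! ### Shannon entropy of discrete random variables, in bits -/

/-- The uniform distribution on a finite nonempty type. -/
def uniform (α : Type*) [Finite α] [Nonempty α] : PMF α :=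
  letI := Fintype.ofFinite α
  PMF.uniformOfFintype α

/-- The joint law of two independent random elements with laws `p` and `q`. -/
def indepProd {α β : Type*} (p : PMF α) (q : PMF β) : PMF (α × β) :=
  p.bind fun a => q.map fun b => (a, b)

/-- The Shannon entropy `H(X)` in bits of a random variable `X` with values in a finite alphabet,
defined on the discrete probability space `(Ω, p)`. (The sum is over the finite type `α`.) -/
def entropy {Ω α : Type*} [Finite α] (p : PMF Ω) (X : Ω → α) : ℝ :=
  ∑' a, Real.negMulLog ((p.map X a).toReal) / Real.log 2

/-- The conditional entropy `H(X | Y) = H(X, Y) - H(Y)`. -/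
def condEntropy {Ω α β : Type*} [Finite α] [Finite β] (p : PMF Ω) (X : Ω → α) (Y : Ω → β) : ℝ :=
  entropy p (fun ω => (X ω, Y ω)) - entropy p Y

/-! ### Private information retrieval over graph-based replication systems

The servers are the vertices of a simple graph `G`, the files are its edges, and the file `e` is
stored exactly on the two endpoints of `e`. -/

/-- The contents of all files: each file is a vector of `L` bits. -/
abbrev Files {V : Type} (G : SimpleGraph V) (L : ℕ) : Type :=
  G.edgeSet → Fin L → ZMod 2

/-- The contents of the files stored on the server `v`. -/
abbrev StoredFiles {V : Type} (G : SimpleGraph V) (L : ℕ) (v : V) : Type :=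
  {e : G.edgeSet // v ∈ e.1} → Fin L → ZMod 2

/-- The part of the database that is stored on the server `v`. -/
def stored {V : Type} {G : SimpleGraph V} {L : ℕ} (W : Files G L) (v : V) : StoredFiles G L v :=
  fun e => W e.1

/-- A retrieval scheme for `G` with file length `L`. The user draws a private random seed,
independently of the files, and from the seed and the index `θ` of the desired file computes a
query for each server. The server `v` answers with a function of the query that it
received and of the files that it stores. -/
structure RetrievalScheme {V : Type} (G : SimpleGraph V) (L : ℕ) where
  /-- The user's private randomness. -/
  Seed : Type
  /-- The law of the private randomness. -/
  seedLaw : PMF Seed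
  /-- The alphabet of the queries sent to a server. -/
  Query : V → Type
  /-- The alphabet of the answers returned by a server. -/
  Answer : V → Type
  finiteQuery : ∀ v, Finite (Query v)
  finiteAnswer : ∀ v, Finite (Answer v)
  /-- The query sent to each server. -/
  query : G.edgeSet → Seed → ∀ v, Query v
  /-- The answer returned by each server. -/
  answer : ∀ v, Query v → StoredFiles G L v → Answer v

attribute [instance] RetrievalScheme.finiteQuery RetrievalScheme.finiteAnswer

namespace RetrievalScheme

variable {V : Type} [Finite V] {G : SimpleGraph V} {L : ℕ}

/-- The joint law of the user's randomness and of the files: the files are independent and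
uniformly distributed, and independent of the user's randomness. -/
def law (T : RetrievalScheme G L) : PMF (T.Seed × Files G L) :=
  indepProd T.seedLaw (uniform (Files G L))

/-- The random variable `Q_v(θ)`. -/
def Q (T : RetrievalScheme G L) (θ : G.edgeSet) (v : V) (ω : T.Seed × Files G L) : T.Query v :=
  T.query θ ω.1 v

/-- The random variable `A_v(θ)`. -/
def A (T : RetrievalScheme G L) (θ : G.edgeSet) (v : V) (ω : T.Seed × Files G L) : T.Answer v :=
  T.answer v (T.Q θ v ω) (stored ω.2 v)

/-- Reliability: the desired file is determined, with zero probability of error, by all the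
answers, together with the queries (which the user knows). -/
def Reliable (T : RetrievalScheme G L) : Prop :=
  ∀ θ : G.edgeSet,
    condEntropy T.law (fun ω => ω.2 θ) (fun ω => (fun v => T.A θ v ω, fun v => T.Q θ v ω)) = 0

/-- Privacy: for each server, the joint law of the query, of the answer and of the stored files
does not depend on the desired file. -/
def IsPrivate (T : RetrievalScheme G L) : Prop :=
  ∀ (v : V) (θ θ' : G.edgeSet),
    T.law.map (fun ω => (T.Q θ v ω, T.A θ v ω, stored ω.2 v)) =
      T.law.map (fun ω => (T.Q θ' v ω, T.A θ' v ω, stored ω.2 v))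

/-- A PIR scheme is a reliable and private retrieval scheme. -/
def IsPIR (T : RetrievalScheme G L) : Prop :=
  T.Reliable ∧ T.IsPrivate

/-- The rate `L / ∑ H(A_v)`, when the desired file is `θ`. (For a private scheme
it does not depend on `θ`.) -/
def rate (T : RetrievalScheme G L) (θ : G.edgeSet) : ℝ :=
  (L : ℝ) / ∑ᶠ v, entropy T.law (T.A θ v)

end RetrievalScheme

/-- The set of the rates of all PIR schemes for `G`, for all positive file lengths. -/
def achievableRates {V : Type} [Finite V] (G : SimpleGraph V) : Set ℝ :=
  {R | ∃ L : ℕ, 0 < L ∧ ∃ T : RetrievalScheme G L, T.IsPIR ∧ ∃ θ, R = T.rate θ}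

/-- `C` is the PIR capacity of `G`: the supremum of the rates of its PIR schemes. -/
def IsPIRCapacity {V : Type} [Finite V] (G : SimpleGraph V) (C : ℝ) : Prop :=
  IsLUB (achievableRates G) C

/-! ### The scheme for the complete graph on `N` servers

Servers and bit positions are numbered from `0`, that is, by `Fin N` and `Fin L`. -/

/-- The file length `L = 3 * 2 ^ (N - 2)`. -/
def fileLength (N : ℕ) : ℕ := 3 * 2 ^ (N - 2)

lemma two_pow_add_eq_fileLength {N : ℕ} (hN : 3 ≤ N) :
    2 ^ (N - 1) + 2 ^ (N - 3) + 2 ^ (N - 3) = fileLength N := by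
  obtain ⟨n, rfl⟩ := Nat.exists_eq_add_of_le' hN
  simp only [fileLength, Nat.add_sub_cancel, show n + 3 - 1 = n + 2 by omega,
    show n + 3 - 2 = n + 1 by omega]
  ring

/-- The embedding of `[2 ^ (N - 1)]` as the initial segment of `[L]`. -/
def lowIndex {N : ℕ} (hN : 3 ≤ N) (t : Fin (2 ^ (N - 1))) : Fin (fileLength N) :=
  ⟨t, by
    have := two_pow_add_eq_fileLength hN; have := t.isLt; have := Nat.two_pow_pos (N - 3); omega⟩

/-- The embedding of `[2 ^ (N - 3)]` as the middle segment of `[L]`, that is, the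
`2 ^ (N - 3)` positions that follow the initial segment of length `2 ^ (N - 1)`. -/
def midIndex {N : ℕ} (hN : 3 ≤ N) (t : Fin (2 ^ (N - 3))) : Fin (fileLength N) :=
  ⟨2 ^ (N - 1) + t, by have := two_pow_add_eq_fileLength hN; have := t.isLt; omega⟩

/-- The embedding of `[2 ^ (N - 3)]` as the last segment of `[L]`: the middle segment shifted
by `2 ^ (N - 3)`. -/
def highIndex {N : ℕ} (hN : 3 ≤ N) (t : Fin (2 ^ (N - 3))) : Fin (fileLength N) :=
  ⟨2 ^ (N - 1) + t + 2 ^ (N - 3), by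
    have := two_pow_add_eq_fileLength hN; have := t.isLt; omega⟩

/-- The file stored on the servers `j` and `l`. -/
def file {N : ℕ} (j l : Fin N) (h : l ≠ j) : (⊤ : SimpleGraph (Fin N)).edgeSet :=
  ⟨s(j, l), by simpa using h.symm⟩

/-- The set `[N] \ {i, i'}`. -/
def others {N : ℕ} (i i' : Fin N) : Finset (Fin N) := Finset.univ \ {i, i'}

/-- The family of the sets of servers that contain exactly one of `i` and `i'`. -/
def famF {N : ℕ} (i i' : Fin N) : Set (Finset (Fin N)) :=
  {P | (P ∩ {i, i'}).card = 1}

/-- The family of the unordered pairs of disjoint sets with union `[N] \ {i, i'}`. -/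
def famG {N : ℕ} (i i' : Fin N) : Set (Sym2 (Finset (Fin N))) :=
  {z | ∃ P₁ P₂, z = s(P₁, P₂) ∧ Disjoint P₁ P₂ ∧ P₁ ∪ P₂ = others i i'}

/-- The nonempty subsets of `N(j) = [N] \ {j}` that contain neither `i` nor `i'`. -/
def restSets {N : ℕ} (i i' j : Fin N) : Set (Finset (Fin N)) :=
  {P | P.Nonempty ∧ j ∉ P ∧ i ∉ P ∧ i' ∉ P}

/-- The choices that the construction leaves open when the desired file is `θ`: the order in which
the two endpoints `i`, `i'` of `θ` are taken, the two bijections `φ` and `ψ`, and, for each server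
`j ≠ i, i'`, an injective assignment `ρ j` of indices in `[2 ^ (N - 1)]`, not used by other sets,
to the nonempty subsets of `N(j)` that avoid `i` and `i'`. The values of `φ`, `ψ`, `ρ`
outside the stated families play no role. -/
structure Choices (N : ℕ) (θ : (⊤ : SimpleGraph (Fin N)).edgeSet) where
  i : Fin N
  i' : Fin N
  eq_edge : θ.1 = s(i, i')
  φ : Finset (Fin N) → Fin (2 ^ (N - 1))
  φ_bij : Set.BijOn φ (famF i i') Set.univ
  ψ : Sym2 (Finset (Fin N)) → Fin (2 ^ (N - 3))
  ψ_bij : Set.BijOn ψ (famG i i') Set.univ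
  ρ : Fin N → Finset (Fin N) → Fin (2 ^ (N - 1))
  ρ_inj : ∀ j, j ≠ i → j ≠ i' → Set.InjOn (ρ j) (restSets i i' j)
  ρ_unused : ∀ j, j ≠ i → j ≠ i' → ∀ P ∈ restSets i i' j, ∀ R ∈ famF i i', j ∉ R →
    ρ j P ≠ φ (insert j R)

namespace Choices

variable {N : ℕ} {θ : (⊤ : SimpleGraph (Fin N)).edgeSet}

open Classical in
/-- The map `σ_j` from the nonempty subsets of `N(j)` to `[L]`. -/
def σ (hN : 3 ≤ N) (c : Choices N θ) (j : Fin N) (P : Finset (Fin N)) : Fin (fileLength N) :=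
  if j = c.i then
    if c.i' ∈ P then lowIndex hN (c.φ (insert c.i (P \ {c.i'})))
    else highIndex hN (c.ψ s(P, others c.i c.i' \ P))
  else if j = c.i' then
    if c.i ∈ P then lowIndex hN (c.φ (insert c.i' (P \ {c.i})))
    else midIndex hN (c.ψ s(P, others c.i c.i' \ P))
  else if P ∈ famF c.i c.i' then lowIndex hN (c.φ (insert j P))
  else if c.i ∈ P ∧ c.i' ∈ P then
    midIndex hN (c.ψ s(insert j (P \ {c.i, c.i'}), others c.i c.i' \ insert j (P \ {c.i, c.i'})))
  else lowIndex hN (c.ρ j P)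

/-- The index at which the server `j` is asked for the sum of all its files, for the pair
`(P₁, P₂)` with `ψ`-value `k`. -/
def τ (hN : 3 ≤ N) (c : Choices N θ) (j : Fin N) (k : Fin (2 ^ (N - 3))) : Fin (fileLength N) :=
  if j = c.i then midIndex hN k else highIndex hN k

end Choices

/-- The nonempty subsets of `N(j)`. -/
abbrev NbrSet {N : ℕ} (j : Fin N) : Type := {P : Finset (Fin N) // P.Nonempty ∧ j ∉ P}

lemma NbrSet.ne_of_mem {N : ℕ} {j l : Fin N} (P : NbrSet j) (hl : l ∈ P.1) : l ≠ j := by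
  rintro rfl
  exact P.2.2 hl

/-- The scheme for the complete graph. The seed consists of one permutation of the bit positions
for each file, all independent and uniform. The server `j` receives, for each nonempty
`P ⊆ N(j)` and each `l ∈ P`, a position in the file shared with `l`, and, for each of the
`2 ^ (N - 3)` pairs of `famG` (listed in the order given by `ψ`), a position in each of
its files; it returns the corresponding sums of bits. -/
def completeScheme (N : ℕ) (hN : 3 ≤ N) (c : ∀ θ, Choices N θ) :
    RetrievalScheme (⊤ : SimpleGraph (Fin N)) (fileLength N) where
  Seed := (⊤ : SimpleGraph (Fin N)).edgeSet → Equiv.Perm (Fin (fileLength N))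
  seedLaw := uniform _
  Query j := (∀ P : NbrSet j, {l // l ∈ P.1} → Fin (fileLength N)) ×
    (Fin (2 ^ (N - 3)) → {l // l ≠ j} → Fin (fileLength N))
  Answer j := (NbrSet j → ZMod 2) × (Fin (2 ^ (N - 3)) → ZMod 2)
  finiteQuery _ := inferInstance
  finiteAnswer _ := inferInstance
  query θ π j :=
    (fun P l => π (file j l.1 (NbrSet.ne_of_mem P l.2)) ((c θ).σ hN j P.1),
      fun k l => π (file j l.1 l.2) ((c θ).τ hN j k))
  answer j q W :=
    (fun P => ∑ l : {l // l ∈ P.1},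
        W ⟨file j l.1 (NbrSet.ne_of_mem P l.2), Sym2.mem_mk_left _ _⟩ (q.1 P l),
      fun k => ∑ l : {l // l ≠ j}, W ⟨file j l.1 l.2, Sym2.mem_mk_left _ _⟩ (q.2 k l))

end GraphPIR

end

/-! Before permutation, each downloaded bit is a sum of the bits of several files at one common
position `t`. Two different sums asked from the same server that involve the same file use different
positions (`Choices.pos_injective_of_involves`). Privacy follows: the position patterns for two
desired files differ by fixed permutations, which the uniform random permutations absorb. The same
fact makes the answer, for each seed, a surjective linear image of the files
(`answerHom_surjective`). It is therefore uniform on `2 ^ (N - 1) - 1 + 2 ^ (N - 3)` bits, which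
gives the rate.

For reliability, fix `t` and view the bits at position `t` as a matrix `v j l` over `ZMod 2`,
symmetric with zero diagonal. The sums read at `t` are partial row sums. In characteristic 2 the
entries of a principal submatrix add up to zero (`sum_sum_eq_zero_of_symm`), and this relation
isolates the entry `v i i'` for `t` in each of the three segments of `[L]`
(`Choices.eq_zero_of_sums`). Since everything is linear, it suffices to treat the difference of two
databases with equal answers.

For the converse on the triangle, let `D` be the total answer entropy and `E(u,v)` the entropy of
the answer of `u` given the queries and the file shared with `v`. By privacy these do not depend on
the desired file. Retrieving the file `uv` gives `D ≥ L + E(u,v) + E(v,u)` (`add_answerEnt_le`).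
Fixing the two other files gives `L ≤ E(u,w) + E(v,w)` (`le_answerEnt_add`). Summed over the three
files, every `E` occurs once on each side, so `3D ≥ 6L`. -/

noncomputable section
namespace GraphPIR

/-! ### Discrete laws on finite types -/

section FiniteLaws

variable {α β : Type*}

/-- The entropy, in nats, of a law on a finite type. -/
def ent (p : PMF α) : ℝ := ∑' a, Real.negMulLog (p a).toReal

/-- The mean of a real function under a law on a finite type. -/
def avg (p : PMF α) (f : α → ℝ) : ℝ := ∑' a, (p a).toReal * f a

lemma ent_eq_sum [Fintype α] (p : PMF α) : ent p = ∑ a, Real.negMulLog (p a).toReal :=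
  tsum_fintype _

lemma avg_eq_sum [Fintype α] (p : PMF α) (f : α → ℝ) : avg p f = ∑ a, (p a).toReal * f a :=
  tsum_fintype _

lemma entropy_eq_ent [Finite α] {Ω : Type*} (p : PMF Ω) (X : Ω → α) :
    entropy p X = ent (p.map X) / Real.log 2 := by
  have := Fintype.ofFinite α
  simp only [entropy, ent, tsum_fintype, Finset.sum_div]

lemma toReal_le_one (p : PMF α) (a : α) : (p a).toReal ≤ 1 :=
  ENNReal.toReal_le_of_le_ofReal zero_le_one (by simpa using p.coe_le_one a)

lemma sum_toReal [Fintype α] (p : PMF α) : ∑ a, (p a).toReal = 1 := by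
  rw [← ENNReal.toReal_sum fun a _ => p.apply_ne_top a, ← tsum_fintype (L := .unconditional α),
    p.tsum_coe, ENNReal.toReal_one]

lemma toReal_bind [Finite α] (p : PMF α) (k : α → PMF β) (b : β) :
    ((p.bind k) b).toReal = avg p fun a => (k a b).toReal := by
  have := Fintype.ofFinite α
  rw [PMF.bind_apply, tsum_fintype, avg_eq_sum,
    ENNReal.toReal_sum fun a _ => ENNReal.mul_ne_top (p.apply_ne_top a) ((k a).apply_ne_top b)]
  simp

lemma avg_bind [Finite α] [Finite β] (p : PMF α) (k : α → PMF β) (f : β → ℝ) :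
    avg (p.bind k) f = avg p fun a => avg (k a) f := by
  have := Fintype.ofFinite α
  have := Fintype.ofFinite β
  simp only [avg_eq_sum, toReal_bind, Finset.sum_mul, Finset.mul_sum]
  rw [Finset.sum_comm]
  simp only [mul_assoc]

lemma avg_pure [Finite α] (a : α) (f : α → ℝ) : avg (PMF.pure a) f = f a := by
  classical
  have := Fintype.ofFinite α
  simp [avg_eq_sum, PMF.pure_apply, apply_ite ENNReal.toReal]

lemma avg_map [Finite α] [Finite β] (p : PMF α) (g : α → β) (f : β → ℝ) :
    avg (p.map g) f = avg p (f ∘ g) := by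
  simp only [PMF.map, avg_bind, avg_pure, Function.comp_def]

lemma avg_const [Finite α] (p : PMF α) (x : ℝ) : avg p (fun _ => x) = x := by
  have := Fintype.ofFinite α
  rw [avg_eq_sum, ← Finset.sum_mul, sum_toReal, one_mul]

lemma avg_add [Finite α] (p : PMF α) (f g : α → ℝ) :
    avg p (fun a => f a + g a) = avg p f + avg p g := by
  have := Fintype.ofFinite α
  simp only [avg_eq_sum, mul_add, Finset.sum_add_distrib]

lemma avg_mono [Finite α] (p : PMF α) {f g : α → ℝ} (h : ∀ a ∈ p.support, f a ≤ g a) :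
    avg p f ≤ avg p g := by
  have := Fintype.ofFinite α
  simp only [avg_eq_sum]
  refine Finset.sum_le_sum fun a _ => ?_
  by_cases ha : p a = 0
  · simp [ha]
  · exact mul_le_mul_of_nonneg_left (h a ha) ENNReal.toReal_nonneg

lemma ent_nonneg (p : PMF α) : 0 ≤ ent p :=
  tsum_nonneg fun a => Real.negMulLog_nonneg ENNReal.toReal_nonneg (toReal_le_one p a)

/-- Concavity of the entropy. -/
lemma avg_ent_le_ent_bind [Finite α] [Finite β] (p : PMF α) (k : α → PMF β) :
    avg p (fun a => ent (k a)) ≤ ent (p.bind k) := by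
  have := Fintype.ofFinite α
  have := Fintype.ofFinite β
  simp only [avg_eq_sum, ent_eq_sum, toReal_bind, Finset.mul_sum]
  rw [Finset.sum_comm]
  refine Finset.sum_le_sum fun b _ => ?_
  exact Real.concaveOn_negMulLog.le_map_sum (fun a _ => ENNReal.toReal_nonneg) (sum_toReal p)
    fun a _ => Set.mem_Ici.2 ENNReal.toReal_nonneg

lemma map_apply_of_injective {α β : Type*} {f : α → β} (hf : f.Injective) (p : PMF α) (a : α) :
    p.map f (f a) = p a := by
  classical
  rw [PMF.map_apply, tsum_eq_single a]
  · simp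
  · intro b hb
    rw [if_neg fun h => hb (hf h).symm]

lemma map_apply_of_notMem_range {α β : Type*} {f : α → β} (p : PMF α) {b : β}
    (hb : b ∉ Set.range f) : p.map f b = 0 := by
  classical
  rw [PMF.map_apply, ENNReal.tsum_eq_zero]
  intro a
  rw [if_neg fun h => hb ⟨a, h.symm⟩]

lemma ent_map_of_injective [Finite α] [Finite β] {f : α → β} (hf : f.Injective) (p : PMF α) :
    ent (p.map f) = ent p := by
  have := Fintype.ofFinite α
  have := Fintype.ofFinite β
  rw [ent_eq_sum, ent_eq_sum]
  symm
  refine Finset.sum_of_injOn f hf.injOn (by simp) (fun b _ hb => ?_) fun a _ => ?_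
  · rw [map_apply_of_notMem_range p (by simpa using hb)]
    simp
  · rw [map_apply_of_injective hf]

/-- The chain rule. -/
lemma ent_bind_pair [Finite α] [Finite β] (p : PMF α) (k : α → PMF β) :
    ent (p.bind fun a => (k a).map (Prod.mk a)) = ent p + avg p fun a => ent (k a) := by
  classical
  have := Fintype.ofFinite α
  have := Fintype.ofFinite β
  have key : ∀ a b, ((p.bind fun a => (k a).map (Prod.mk a)) (a, b)).toReal =
      (p a).toReal * (k a b).toReal := by
    intro a b
    rw [toReal_bind, avg_eq_sum, Finset.sum_eq_single a]
    · rw [map_apply_of_injective (Prod.mk_right_injective a)]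
    · intro a' _ h
      rw [map_apply_of_notMem_range]
      · simp
      · rintro ⟨x, hx⟩
        exact h (Prod.mk.inj hx).1
    · simp
  simp only [ent_eq_sum, avg_eq_sum, Fintype.sum_prod_type, key, Real.negMulLog_mul,
    Finset.sum_add_distrib, Finset.mul_sum, ← Finset.sum_mul, sum_toReal, one_mul]

lemma toReal_map_fst [Finite α] [Fintype β] (p : PMF (α × β)) (a : α) :
    (p.map Prod.fst a).toReal = ∑ b, (p (a, b)).toReal := by
  classical
  have := Fintype.ofFinite α
  rw [PMF.map_apply, tsum_fintype, Fintype.sum_prod_type, Finset.sum_eq_single a]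
  · simp only [if_true]
    exact ENNReal.toReal_sum fun b _ => p.apply_ne_top _
  · intro a' _ h
    simp [h.symm]
  · simp

lemma toReal_map_snd [Finite β] [Fintype α] (p : PMF (α × β)) (b : β) :
    (p.map Prod.snd b).toReal = ∑ a, (p (a, b)).toReal := by
  classical
  have := Fintype.ofFinite β
  rw [PMF.map_apply, tsum_fintype, Fintype.sum_prod_type_right, Finset.sum_eq_single b]
  · simp only [if_true]
    exact ENNReal.toReal_sum fun b _ => p.apply_ne_top _
  · intro a' _ h
    simp [h.symm]
  · simp

/-- Subadditivity of the entropy. -/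
lemma ent_le_add [Finite α] [Finite β] (p : PMF (α × β)) :
    ent p ≤ ent (p.map Prod.fst) + ent (p.map Prod.snd) := by
  have := Fintype.ofFinite α
  have := Fintype.ofFinite β
  set P := fun a b => (p (a, b)).toReal with hP
  set P₁ := fun a => (p.map Prod.fst a).toReal with hP₁
  set P₂ := fun b => (p.map Prod.snd b).toReal with hP₂
  have h₁ : ∀ a, P₁ a = ∑ b, P a b := toReal_map_fst p
  have h₂ : ∀ b, P₂ b = ∑ a, P a b := toReal_map_snd p
  have s₁ : ∑ a, P₁ a = 1 := sum_toReal _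
  have s₂ : ∑ b, P₂ b = 1 := sum_toReal _
  have hnn : ∀ a b, 0 ≤ P a b := fun a b => ENNReal.toReal_nonneg
  have e₁ : ent (p.map Prod.fst) = ∑ a, ∑ b, - (P a b * Real.log (P₁ a)) := by
    rw [ent_eq_sum]
    refine Finset.sum_congr rfl fun a _ => ?_
    rw [Finset.sum_neg_distrib, ← Finset.sum_mul, ← h₁, Real.negMulLog, neg_mul]
  have e₂ : ent (p.map Prod.snd) = ∑ a, ∑ b, - (P a b * Real.log (P₂ b)) := by
    rw [ent_eq_sum, Finset.sum_comm]
    refine Finset.sum_congr rfl fun b _ => ?_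
    rw [Finset.sum_neg_distrib, ← Finset.sum_mul, ← h₂, Real.negMulLog, neg_mul]
  -- This is `log x ≤ x - 1` at `x = P₁ a * P₂ b / P a b`, multiplied by `P a b`. The correction `P
  -- a b - P₁ a * P₂ b` sums to zero.
  have key : ∀ a b, Real.negMulLog (P a b) + (P a b - P₁ a * P₂ b) ≤
      - (P a b * Real.log (P₁ a)) + - (P a b * Real.log (P₂ b)) := by
    intro a b
    rcases (hnn a b).eq_or_lt with h | h
    · have : 0 ≤ P₁ a * P₂ b := mul_nonneg ENNReal.toReal_nonneg ENNReal.toReal_nonneg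
      simp [← h, this]
    · have p₁ : 0 < P₁ a := h.trans_le <| by
        rw [h₁]; exact Finset.single_le_sum (fun b _ => hnn a b) (Finset.mem_univ b)
      have p₂ : 0 < P₂ b := h.trans_le <| by
        rw [h₂]; exact Finset.single_le_sum (fun a _ => hnn a b) (Finset.mem_univ a)
      have hl := Real.log_le_sub_one_of_pos (div_pos (mul_pos p₁ p₂) h)
      rw [Real.log_div (mul_pos p₁ p₂).ne' h.ne', Real.log_mul p₁.ne' p₂.ne'] at hl
      have := mul_le_mul_of_nonneg_left hl h.le
      rw [mul_sub _ (_ / _), mul_div_cancel₀ _ h.ne'] at this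
      rw [Real.negMulLog]
      linarith
  have hsum := Finset.sum_le_sum fun a (_ : a ∈ Finset.univ) =>
    Finset.sum_le_sum fun b (_ : b ∈ Finset.univ) => key a b
  simp only [Finset.sum_add_distrib, Finset.sum_sub_distrib, ← Finset.mul_sum, s₂, mul_one,
    ← h₁, sub_self, add_zero] at hsum
  rw [e₁, e₂, ent_eq_sum, Fintype.sum_prod_type]
  simpa only [Finset.sum_add_distrib] using hsum

lemma ent_map_pair_le [Finite α] [Finite β] {Ω : Type*} (p : PMF Ω) (X : Ω → α) (Y : Ω → β) :
    ent (p.map fun ω => (X ω, Y ω)) ≤ ent (p.map X) + ent (p.map Y) := by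
  have := ent_le_add (p.map fun ω => (X ω, Y ω))
  rwa [PMF.map_comp, PMF.map_comp] at this

/-- If `H(X, Y) = H(Y)`, then `X` is determined by `Y` on the support. -/
lemma eq_of_ent_eq_ent_snd [Finite α] [Finite β] {p : PMF (α × β)}
    (h : ent p = ent (p.map Prod.snd)) {a a' : α} {b : β}
    (ha : (a, b) ∈ p.support) (ha' : (a', b) ∈ p.support) : a = a' := by
  have := Fintype.ofFinite α
  have := Fintype.ofFinite β
  set P := fun a b => (p (a, b)).toReal with hP
  set P₂ := fun b => (p.map Prod.snd b).toReal with hP₂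
  have h₂ : ∀ b, P₂ b = ∑ a, P a b := toReal_map_snd p
  have hnn : ∀ a b, 0 ≤ P a b := fun a b => ENNReal.toReal_nonneg
  have hpos : ∀ a b, (a, b) ∈ p.support → 0 < P a b := fun a b h =>
    ENNReal.toReal_pos h (p.apply_ne_top _)
  have e₂ : ent (p.map Prod.snd) = ∑ a, ∑ b, - (P a b * Real.log (P₂ b)) := by
    rw [ent_eq_sum, Finset.sum_comm]
    refine Finset.sum_congr rfl fun b _ => ?_
    rw [Finset.sum_neg_distrib, ← Finset.sum_mul, ← h₂, Real.negMulLog, neg_mul]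
  have hle : ∀ a b, P a b ≤ P₂ b := fun a b => by
    rw [h₂]; exact Finset.single_le_sum (fun a _ => hnn a b) (Finset.mem_univ a)
  have key : ∀ a b, - (P a b * Real.log (P₂ b)) ≤ Real.negMulLog (P a b) := by
    intro a b
    rcases (hnn a b).eq_or_lt with h | h
    · simp [← h]
    · have := mul_le_mul_of_nonneg_left (Real.log_le_log h (hle a b)) h.le
      rw [Real.negMulLog]; linarith
  rw [e₂, ent_eq_sum, Fintype.sum_prod_type] at h
  -- The two sums compare term by term, so equality of the totals forces equality in every term: the
  -- atom `(a, b)` carries all the mass lying over `b`, and no second atom fits.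
  have heq := (Finset.sum_eq_sum_iff_of_le fun a _ => Finset.sum_le_sum fun b _ => key a b).1 h.symm
  have heq' := (Finset.sum_eq_sum_iff_of_le fun b _ => key a b).1 (heq a (Finset.mem_univ _)) b
    (Finset.mem_univ _)
  have hp := hpos a b ha
  have hlog : Real.log (P₂ b) = Real.log (P a b) := by
    rw [Real.negMulLog] at heq'
    exact mul_left_cancel₀ hp.ne' (by linarith)
  have hPeq : P₂ b = P a b :=
    Real.log_injOn_pos (hp.trans_le (hle a b)) hp hlog
  by_contra hne
  have hp' := hpos a' b ha'
  have : P a b + P a' b ≤ P₂ b := by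
    classical
    rw [h₂, ← Finset.sum_pair hne (f := fun a => P a b)]
    exact Finset.sum_le_sum_of_subset_of_nonneg (Finset.subset_univ _) fun a _ _ => hnn a b
  linarith

/-! ### Uniform laws -/

variable [Finite α] [Nonempty α] [Finite β] [Nonempty β]

lemma uniform_apply (a : α) : uniform α a = (Nat.card α : ENNReal)⁻¹ := by
  let := Fintype.ofFinite α
  rw [Nat.card_eq_fintype_card]
  exact PMF.uniformOfFintype_apply a

lemma eq_uniform {p : PMF α} (h : ∀ a b, p a = p b) : p = uniform α := by
  have := Fintype.ofFinite α
  ext a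
  have hs := p.tsum_coe
  rw [tsum_fintype, Finset.sum_congr rfl fun b _ => h b a, Finset.sum_const, Finset.card_univ,
    ← Nat.card_eq_fintype_card, nsmul_eq_mul, mul_comm] at hs
  rw [uniform_apply]
  exact ENNReal.eq_inv_of_mul_eq_one_left hs

lemma uniform_map_equiv (e : α ≃ β) : (uniform α).map e = uniform β := by
  refine eq_uniform fun b b' => ?_
  rw [← e.apply_symm_apply b, ← e.apply_symm_apply b', map_apply_of_injective e.injective,
    map_apply_of_injective e.injective, uniform_apply, uniform_apply]

lemma indepProd_uniform : indepProd (uniform α) (uniform β) = uniform (α × β) := by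
  refine eq_uniform ?_
  have key : ∀ a b, indepProd (uniform α) (uniform β) (a, b) =
      (Nat.card α : ENNReal)⁻¹ * (Nat.card β : ENNReal)⁻¹ := by
    intro a b
    rw [indepProd, PMF.bind_apply, tsum_eq_single a]
    · rw [map_apply_of_injective (Prod.mk_right_injective a), uniform_apply, uniform_apply]
    · intro a' h
      rw [map_apply_of_notMem_range, mul_zero]
      rintro ⟨x, hx⟩
      exact h (Prod.mk.inj hx).1
  rintro ⟨a, b⟩ ⟨a', b'⟩
  rw [key, key]

/-- Translation by a preimage of `-b + b'` carries the fibre over `b` onto the fibre over `b'`, so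
all fibres have the same mass. -/
lemma uniform_map_of_surjective [AddGroup α] [AddGroup β] (f : α →+ β)
    (hf : Function.Surjective f) : (uniform α).map f = uniform β := by
  classical
  refine eq_uniform fun b b' => ?_
  obtain ⟨c, hc⟩ := hf (-b + b')
  simp only [PMF.map_apply, uniform_apply]
  rw [← (Equiv.addRight c).tsum_eq (fun a => if b' = f a then (Nat.card α : ENNReal)⁻¹ else 0)]
  refine tsum_congr fun a => ?_
  have : b = f a ↔ b' = f ((Equiv.addRight c) a) := by
    simp only [Equiv.coe_addRight, map_add, hc, ← add_assoc]
    rw [eq_comm (a := b'), add_eq_right, ← sub_eq_add_neg, sub_eq_zero, eq_comm]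
  simp only [this]

lemma ent_uniform : ent (uniform α) = Real.log (Nat.card α) := by
  have := Fintype.ofFinite α
  have hc : (Nat.card α : ℝ) ≠ 0 := Nat.cast_ne_zero.2 Nat.card_pos.ne'
  simp only [ent_eq_sum, uniform_apply, ENNReal.toReal_inv, ENNReal.toReal_natCast,
    Finset.sum_const, Finset.card_univ, ← Nat.card_eq_fintype_card, Real.negMulLog, nsmul_eq_mul,
    Real.log_inv]
  field_simp

lemma mem_support_uniform (a : α) : a ∈ (uniform α).support := by
  rw [PMF.mem_support_iff, uniform_apply]
  simp

end FiniteLaws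

/-! ### Laws of observables of a retrieval scheme -/

namespace RetrievalScheme

variable {V : Type} [Finite V] {G : SimpleGraph V} {L : ℕ}

/-- Seed and files are independent, so an observable that sees the seed only through `g` is a
mixture, over the values of `g`, of images of the uniform law. With `g` a query, this is
conditioning on the query. -/
lemma law_map (T : RetrievalScheme G L) {X Y : Type*} (g : T.Seed → X) (F : X → Files G L → Y) :
    T.law.map (fun ω => F (g ω.1) ω.2) =
      (T.seedLaw.map g).bind fun x => (uniform (Files G L)).map (F x) := by
  rw [law, indepProd, PMF.map_bind, PMF.bind_map]
  congr 1
  funext s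
  rw [PMF.map_comp]
  rfl

lemma entropy_A_of_forall_seed (T : RetrievalScheme G L) {θ : G.edgeSet} {v : V}
    {μ : PMF (T.Answer v)} (h : ∀ s, (uniform (Files G L)).map
      (fun W => T.answer v (T.query θ s v) (stored W v)) = μ) :
    entropy T.law (T.A θ v) = ent μ / Real.log 2 := by
  have key := T.law_map id fun s W => T.answer v (T.query θ s v) (stored W v)
  simp only [h, PMF.bind_const] at key
  rw [entropy_eq_ent, ← key]
  rfl

/-- The answer is a function of the query and the stored files, and the query is independent of the
files; the desired file enters only through the law of the query. -/
lemma isPrivate_of_query (T : RetrievalScheme G L)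
    (h : ∀ v θ θ', T.seedLaw.map (fun s => T.query θ s v) = T.seedLaw.map fun s => T.query θ' s v) :
    T.IsPrivate := by
  intro v θ θ'
  have := fun θ => T.law_map (fun s => T.query θ s v)
    fun q W => (q, T.answer v q (stored W v), stored W v)
  simp only [Q, A]
  rw [this, this, h v θ θ']

/-- A scheme is reliable if the answers and queries determine the desired file. -/
lemma reliable_of_determined (T : RetrievalScheme G L)
    (h : ∀ θ ω ω', (∀ v, T.Q θ v ω = T.Q θ v ω') → (∀ v, T.A θ v ω = T.A θ v ω') →
      ω.2 θ = ω'.2 θ) : T.Reliable := by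
  intro θ
  set Y : T.Seed × Files G L → _ := fun ω => (fun v => T.A θ v ω, fun v => T.Q θ v ω) with hY
  have hf : Function.FactorsThrough (fun ω : T.Seed × Files G L => ω.2 θ) Y := by
    intro ω ω' hω
    exact h θ ω ω' (congrFun (congrArg Prod.snd hω)) (congrFun (congrArg Prod.fst hω))
  obtain ⟨g, hg⟩ := (Function.factorsThrough_iff _).1 hf
  -- As `X` is a function of `Y`, the pair `(X, Y)` is an injective image of `Y` and has the same
  -- entropy.
  have hX : (fun ω : T.Seed × Files G L => (ω.2 θ, Y ω)) = (fun y => (g y, y)) ∘ Y := by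
    funext ω
    exact Prod.ext (congrFun hg ω) rfl
  rw [condEntropy, entropy_eq_ent, entropy_eq_ent, hX, ← PMF.map_comp,
    ent_map_of_injective (f := fun y => (g y, y)) (fun a b hab => (Prod.mk.inj hab).2), sub_self]

end RetrievalScheme

/-! ### Positions -/

variable {N : ℕ}

lemma lowIndex_injective (hN : 3 ≤ N) : Function.Injective (lowIndex hN) := fun _ _ h =>
  Fin.ext (congrArg Fin.val h :)

lemma midIndex_injective (hN : 3 ≤ N) : Function.Injective (midIndex hN) := fun a b h => by
  have : 2 ^ (N - 1) + (a : ℕ) = 2 ^ (N - 1) + b := congrArg Fin.val h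
  exact Fin.ext (by omega)

lemma highIndex_injective (hN : 3 ≤ N) : Function.Injective (highIndex hN) := fun a b h => by
  have : 2 ^ (N - 1) + (a : ℕ) + 2 ^ (N - 3) = 2 ^ (N - 1) + b + 2 ^ (N - 3) :=
    congrArg Fin.val h
  exact Fin.ext (by omega)

lemma lowIndex_ne_midIndex (hN : 3 ≤ N) (a b) : lowIndex hN a ≠ midIndex hN b := fun h => by
  have : (a : ℕ) = 2 ^ (N - 1) + b := congrArg Fin.val h
  have := a.isLt
  omega

lemma lowIndex_ne_highIndex (hN : 3 ≤ N) (a b) : lowIndex hN a ≠ highIndex hN b := fun h => by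
  have : (a : ℕ) = 2 ^ (N - 1) + b + 2 ^ (N - 3) := congrArg Fin.val h
  have := a.isLt
  omega

lemma midIndex_ne_highIndex (hN : 3 ≤ N) (a b) : midIndex hN a ≠ highIndex hN b := fun h => by
  have : 2 ^ (N - 1) + (a : ℕ) = 2 ^ (N - 1) + b + 2 ^ (N - 3) := congrArg Fin.val h
  have := a.isLt
  omega

lemma index_cases (hN : 3 ≤ N) (t : Fin (fileLength N)) :
    (∃ s, lowIndex hN s = t) ∨ (∃ k, midIndex hN k = t) ∨ ∃ k, highIndex hN k = t := by
  have h := two_pow_add_eq_fileLength hN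
  have ht := t.isLt
  by_cases h₁ : (t : ℕ) < 2 ^ (N - 1)
  · exact .inl ⟨⟨t, h₁⟩, rfl⟩
  by_cases h₂ : (t : ℕ) < 2 ^ (N - 1) + 2 ^ (N - 3)
  · exact .inr (.inl ⟨⟨t - 2 ^ (N - 1), by omega⟩, Fin.ext (by simp only [midIndex]; omega)⟩)
  · exact .inr (.inr ⟨⟨t - 2 ^ (N - 1) - 2 ^ (N - 3), by omega⟩,
      Fin.ext (by simp only [highIndex]; omega)⟩)

lemma mem_famF {i i' : Fin N} (h : i ≠ i') {P : Finset (Fin N)} :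
    P ∈ famF i i' ↔ ¬(i ∈ P ↔ i' ∈ P) := by
  rw [famF, Set.mem_ofPred_eq]
  by_cases h₁ : i ∈ P <;> by_cases h₂ : i' ∈ P <;>
    simp [Finset.inter_insert_of_mem, Finset.inter_insert_of_notMem, h₁, h₂, h]

lemma mem_others {i i' j : Fin N} : j ∈ others i i' ↔ j ≠ i ∧ j ≠ i' := by
  simp [others]

lemma mk_mem_famG {i i' : Fin N} {P : Finset (Fin N)} (h : i ∉ P) (h' : i' ∉ P) :
    s(P, others i i' \ P) ∈ famG i i' := by
  refine ⟨P, _, rfl, Finset.disjoint_sdiff, Finset.union_sdiff_of_subset fun l hl => ?_⟩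
  exact mem_others.2 ⟨fun e => h (e ▸ hl), fun e => h' (e ▸ hl)⟩

namespace Choices

variable {θ : (⊤ : SimpleGraph (Fin N)).edgeSet}

lemma ne (c : Choices N θ) : c.i ≠ c.i' := by
  have := θ.2
  rw [c.eq_edge] at this
  simpa using this

/-- An unordered pair determines `P` only up to complement in `others`; the common element `l`
excludes the complement. -/
lemma ψ_injective_of_mem (c : Choices N θ) {P P' : Finset (Fin N)} {l : Fin N}
    (hl : l ∈ P) (hl' : l ∈ P') (hi : c.i ∉ P) (hi' : c.i' ∉ P) (ki : c.i ∉ P') (ki' : c.i' ∉ P')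
    (h : c.ψ s(P, others c.i c.i' \ P) = c.ψ s(P', others c.i c.i' \ P')) : P = P' := by
  have := c.ψ_bij.injOn (mk_mem_famG hi hi') (mk_mem_famG ki ki') h
  rw [Sym2.eq_iff] at this
  rcases this with h | h
  · exact h.1
  · rw [h.1] at hl
    exact absurd hl' (Finset.mem_sdiff.1 hl).2

/-- Two sums asked from the same server that involve a common file use distinct positions. -/
lemma σ_injective_of_mem (hN : 3 ≤ N) (c : Choices N θ) {j l : Fin N} {P P' : Finset (Fin N)}
    (hP : j ∉ P) (hP' : j ∉ P') (hl : l ∈ P) (hl' : l ∈ P') (h : c.σ hN j P = c.σ hN j P') :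
    P = P' := by
  have hne := c.ne
  have F := fun P => mem_famF (P := P) hne
  unfold σ at h
  split_ifs at h with h1 h2 h3 h3 h4 h5 h6 h6 h7 h8 h9 h10 h11 h8 h9 h10
  -- The three segments of `[L]` are disjoint, so only sets sent to the same segment need to be
  -- compared.
  all_goals first
    | exact absurd h (lowIndex_ne_highIndex hN _ _)
    | exact absurd h.symm (lowIndex_ne_highIndex hN _ _)
    | exact absurd h (lowIndex_ne_midIndex hN _ _)
    | exact absurd h.symm (lowIndex_ne_midIndex hN _ _)
    | skip
  · subst h1
    have := c.φ_bij.injOn ((F _).2 (by grind)) ((F _).2 (by grind)) (lowIndex_injective hN h)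
    ext x
    have := congrArg (x ∈ ·) this
    grind
  · subst h1
    exact c.ψ_injective_of_mem hl hl' hP h2 hP' h3 (highIndex_injective hN h)
  · subst h4
    have := c.φ_bij.injOn ((F _).2 (by grind)) ((F _).2 (by grind)) (lowIndex_injective hN h)
    ext x
    have := congrArg (x ∈ ·) this
    grind
  · subst h4
    exact c.ψ_injective_of_mem hl hl' h5 hP h6 hP' (midIndex_injective hN h)
  · have := c.φ_bij.injOn ((F _).2 (by grind)) ((F _).2 (by grind)) (lowIndex_injective hN h)
    ext x
    have := congrArg (x ∈ ·) this
    grind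
  · exact absurd (lowIndex_injective hN h).symm
      (c.ρ_unused j h1 h4 P' ⟨⟨l, hl'⟩, hP', by grind, by grind⟩ P h7 hP)
  -- Both arguments of `ψ` have been completed by `j`, which serves as the common element.
  · have := c.ψ_injective_of_mem (Finset.mem_insert_self j _) (Finset.mem_insert_self j _)
      (by grind) (by grind) (by grind) (by grind) (midIndex_injective hN h)
    ext x
    have := congrArg (x ∈ ·) this
    grind
  · exact absurd (lowIndex_injective hN h)
      (c.ρ_unused j h1 h4 P ⟨⟨l, hl⟩, hP, by grind, by grind⟩ P' h9 hP')
  · exact c.ρ_inj j h1 h4 ⟨⟨l, hl⟩, hP, by grind, by grind⟩ ⟨⟨l, hl'⟩, hP', by grind, by grind⟩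
      (lowIndex_injective hN h)

/-- The server `i` reads `σ` in the low and high segments and `τ` in the middle one; every other
server reads `σ` in the low and middle segments and `τ` in the high one. -/
lemma σ_ne_τ (hN : 3 ≤ N) (c : Choices N θ) (j : Fin N) (P : Finset (Fin N)) (k) :
    c.σ hN j P ≠ c.τ hN j k := by
  unfold σ τ
  split_ifs <;> first
    | exact lowIndex_ne_midIndex hN _ _
    | exact lowIndex_ne_highIndex hN _ _
    | exact midIndex_ne_highIndex hN _ _
    | exact (midIndex_ne_highIndex hN _ _).symm

lemma τ_injective (hN : 3 ≤ N) (c : Choices N θ) (j : Fin N) : Function.Injective (c.τ hN j) := by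
  intro k k' h
  unfold τ at h
  split_ifs at h
  · exact midIndex_injective hN h
  · exact highIndex_injective hN h

end Choices

/-! ### The sums asked from one server and the positions that they read -/

lemma file_symm (j l : Fin N) (h : l ≠ j) : file j l h = file l j h.symm :=
  Subtype.ext Sym2.eq_swap

lemma file_inj {j l l' : Fin N} {h : l ≠ j} {h' : l' ≠ j} (e : file j l h = file j l' h') :
    l = l' := by
  have := congrArg Subtype.val e
  simp only [file, Sym2.eq_iff] at this
  rcases this with h | h
  · exact h.2
  · exact h.2.trans h.1

/-- The index set of the sums that are asked from the server `j`. -/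
abbrev SumIndex (j : Fin N) : Type := NbrSet j ⊕ Fin (2 ^ (N - 3))

/-- The sum `a`, asked from the server `j`, involves the file shared with `l`. -/
def SumIndex.Involves {j : Fin N} (a : SumIndex j) (l : Fin N) : Prop :=
  a.elim (fun P => l ∈ P.1) fun _ => l ≠ j

lemma SumIndex.Involves.ne {j : Fin N} {a : SumIndex j} {l : Fin N} (h : a.Involves l) :
    l ≠ j := by
  cases a with
  | inl P => exact P.ne_of_mem h
  | inr k => exact h

lemma SumIndex.exists_involves (hN : 3 ≤ N) {j : Fin N} (a : SumIndex j) : ∃ l, a.Involves l := by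
  cases a with
  | inl P => exact P.2.1
  | inr k =>
    have : Nontrivial (Fin N) := Fin.nontrivial_iff_two_le.2 (by omega)
    exact exists_ne j

namespace Choices

variable {θ θ' : (⊤ : SimpleGraph (Fin N)).edgeSet}

/-- The position at which the files of the sum `a` are read, before permutation. -/
def pos (hN : 3 ≤ N) (c : Choices N θ) {j : Fin N} (a : SumIndex j) : Fin (fileLength N) :=
  a.elim (fun P => c.σ hN j P.1) fun k => c.τ hN j k

lemma pos_injective_of_involves (hN : 3 ≤ N) (c : Choices N θ) {j l : Fin N} {a b : SumIndex j}
    (ha : a.Involves l) (hb : b.Involves l) (h : c.pos hN a = c.pos hN b) : a = b := by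
  rcases a with P | k <;> rcases b with P' | k'
  · exact congrArg _ (Subtype.ext (c.σ_injective_of_mem hN P.2.2 P'.2.2 ha hb h))
  · exact absurd h (c.σ_ne_τ hN j _ _)
  · exact absurd h.symm (c.σ_ne_τ hN j _ _)
  · exact congrArg _ (c.τ_injective hN j h)

/-- Both choices read the file `{j, l}` at distinct positions indexed by the same sums; a bijection
between two subsets of a finite set extends to a permutation. -/
lemma exists_perm_pos (hN : 3 ≤ N) (c : Choices N θ) (c' : Choices N θ') (j l : Fin N) :
    ∃ p : Equiv.Perm (Fin (fileLength N)),
      ∀ a : SumIndex j, a.Involves l → p (c'.pos hN a) = c.pos hN a := by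
  classical
  have inj := fun {θ} (c : Choices N θ) =>
    show Function.Injective fun a : {a : SumIndex j // a.Involves l} => c.pos hN a.1 from
      fun a b h => Subtype.ext (c.pos_injective_of_involves hN a.2 b.2 h)
  let e := (Equiv.ofInjective _ (inj c')).symm.trans (Equiv.ofInjective _ (inj c))
  refine ⟨e.extendSubtype, fun a ha => ?_⟩
  rw [Equiv.extendSubtype_apply_of_mem e _ ⟨⟨a, ha⟩, rfl⟩]
  have : (⟨c'.pos hN a, ⟨⟨a, ha⟩, rfl⟩⟩ : Set.range _) =
    Equiv.ofInjective _ (inj c') ⟨a, ha⟩ := rfl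
  simp only [e, Equiv.trans_apply]
  erw [this, Equiv.symm_apply_apply]
  rfl

end Choices

/-! ### Privacy and answer entropy of the complete scheme -/

section CompleteScheme

variable (hN : 3 ≤ N) (c : ∀ θ, Choices N θ)

/-- At the server `j`, the query for `θ` is the query for `θ'` evaluated at the seed multiplied on
the right by a fixed family `p`, and this multiplication preserves the uniform law. Files not stored
on `j` get the identity. -/
lemma completeScheme_isPrivate : (completeScheme N hN c).IsPrivate := by
  refine RetrievalScheme.isPrivate_of_query _ fun j θ θ' => ?_
  have : ∀ e : (⊤ : SimpleGraph (Fin N)).edgeSet, ∃ p : Equiv.Perm (Fin (fileLength N)),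
      ∀ (l : Fin N) (h : l ≠ j), e = file j l h → ∀ a : SumIndex j, a.Involves l →
        p ((c θ').pos hN a) = (c θ).pos hN a := by
    intro e
    by_cases he : ∃ (l : Fin N) (h : l ≠ j), e = file j l h
    · obtain ⟨l, h, rfl⟩ := he
      obtain ⟨p, hp⟩ := (c θ).exists_perm_pos hN (c θ') j l
      refine ⟨p, fun l' h' e => ?_⟩
      cases file_inj e
      exact hp
    · exact ⟨1, fun l h e => absurd ⟨l, h, e⟩ he⟩
  choose p hp using this
  let q (θ) (π : (⊤ : SimpleGraph (Fin N)).edgeSet → Equiv.Perm (Fin (fileLength N))) :=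
    (completeScheme N hN c).query θ π j
  have hq : q θ = q θ' ∘ Equiv.mulRight p := by
    funext π
    refine Prod.ext (funext fun P => funext fun l => ?_) (funext fun k => funext fun l => ?_)
    · exact congrArg (π (file j l.1 (NbrSet.ne_of_mem P l.2)))
        (hp _ l.1 (NbrSet.ne_of_mem P l.2) rfl (.inl P) l.2).symm
    · exact congrArg (π (file j l.1 l.2)) (hp _ l.1 l.2 rfl (.inr k) l.2).symm
  change (uniform _).map (q θ) = (uniform _).map (q θ')
  rw [hq, ← PMF.map_comp, uniform_map_equiv]

/-- For each seed, the answer of a server is a linear map of the files. -/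
def answerHom (θ : (⊤ : SimpleGraph (Fin N)).edgeSet) (j : Fin N)
    (π : (⊤ : SimpleGraph (Fin N)).edgeSet → Equiv.Perm (Fin (fileLength N))) :
    Files (⊤ : SimpleGraph (Fin N)) (fileLength N) →+
      (NbrSet j → ZMod 2) × (Fin (2 ^ (N - 3)) → ZMod 2) where
  toFun W := (completeScheme N hN c).answer j ((completeScheme N hN c).query θ π j) (stored W j)
  map_zero' := by
    ext <;> simp [completeScheme, stored]
  map_add' W W' := by
    ext <;> simp [completeScheme, stored, Finset.sum_add_distrib]

/-- Choose for each sum one file that it involves, put the prescribed value at the bit read there,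
and zeros elsewhere. No other sum from this server reads that bit, so the values can be prescribed
independently. -/
lemma answerHom_surjective (θ : (⊤ : SimpleGraph (Fin N)).edgeSet) (j : Fin N)
    (π : (⊤ : SimpleGraph (Fin N)).edgeSet → Equiv.Perm (Fin (fileLength N))) :
    Function.Surjective (answerHom hN c θ j π) := by
  classical
  intro x
  choose l hl using fun a : SumIndex j => a.exists_involves hN
  let hit (e : (⊤ : SimpleGraph (Fin N)).edgeSet) (s : Fin (fileLength N)) (a : SumIndex j) :=
    e = file j (l a) (hl a).ne ∧ s = π e ((c θ).pos hN a)
  let W : Files (⊤ : SimpleGraph (Fin N)) (fileLength N) := fun e s =>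
    if h : ∃ a, hit e s a then Sum.elim x.1 x.2 h.choose else 0
  have key : ∀ (a : SumIndex j) (m : Fin N) (hm : a.Involves m) (a' : SumIndex j),
      hit (file j m hm.ne) (π (file j m hm.ne) ((c θ).pos hN a)) a' → a = a' ∧ m = l a' := by
    intro a m hm a' h
    have hml := file_inj h.1
    refine ⟨(c θ).pos_injective_of_involves hN hm ?_ ((π _).injective h.2), hml⟩
    rw [hml]
    exact hl a'
  have hW₁ : ∀ a : SumIndex j, W (file j (l a) (hl a).ne)
      (π (file j (l a) (hl a).ne) ((c θ).pos hN a)) = Sum.elim x.1 x.2 a := by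
    intro a
    have h : ∃ a', hit (file j (l a) (hl a).ne)
      (π (file j (l a) (hl a).ne) ((c θ).pos hN a)) a' := ⟨a, rfl, rfl⟩
    simp only [W]
    rw [dif_pos h, ← (key a (l a) (hl a) _ h.choose_spec).1]
  have hW₀ : ∀ (a : SumIndex j) (m : Fin N) (hm : a.Involves m), m ≠ l a →
      W (file j m hm.ne) (π (file j m hm.ne) ((c θ).pos hN a)) = 0 := by
    intro a m hm hne
    simp only [W]
    rw [dif_neg]
    rintro ⟨a', h⟩
    obtain ⟨rfl, h⟩ := key a m hm a' h
    exact hne h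
  refine ⟨W, Prod.ext (funext fun P => ?_) (funext fun k => ?_)⟩
  · refine Eq.trans ?_ (hW₁ (.inl P))
    exact Fintype.sum_eq_single (⟨l (.inl P), hl (.inl P)⟩ : {l // l ∈ P.1}) fun m hm =>
      hW₀ (.inl P) m.1 m.2 fun h => hm (Subtype.ext h)
  · refine Eq.trans ?_ (hW₁ (.inr k))
    exact Fintype.sum_eq_single (⟨l (.inr k), hl (.inr k)⟩ : {l // l ≠ j}) fun m hm =>
      hW₀ (.inr k) m.1 m.2 fun h => hm (Subtype.ext h)

lemma card_nbrSet (j : Fin N) : Nat.card (NbrSet j) = 2 ^ (N - 1) - 1 := by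
  classical
  have : ((Finset.univ.erase j).powerset.erase ∅).card = 2 ^ (N - 1) - 1 := by
    rw [Finset.card_erase_of_mem (Finset.empty_mem_powerset _), Finset.card_powerset,
      Finset.card_erase_of_mem (Finset.mem_univ _), Finset.card_univ, Fintype.card_fin]
  rw [← this, Nat.card_eq_fintype_card]
  refine Fintype.card_of_subtype _ fun P => ?_
  simp [Finset.mem_erase, Finset.nonempty_iff_ne_empty, Finset.subset_erase]

lemma entropy_completeScheme_A (θ : (⊤ : SimpleGraph (Fin N)).edgeSet) (j : Fin N) :
    entropy (completeScheme N hN c).law ((completeScheme N hN c).A θ j) =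
      2 ^ (N - 1) + 2 ^ (N - 3) - 1 := by
  rw [(completeScheme N hN c).entropy_A_of_forall_seed fun π =>
    uniform_map_of_surjective (answerHom hN c θ j π) (answerHom_surjective hN c θ j π)]
  change ent (uniform ((NbrSet j → ZMod 2) × (Fin (2 ^ (N - 3)) → ZMod 2))) / _ = _
  rw [ent_uniform]
  have hlog : Real.log 2 ≠ 0 := (Real.log_pos one_lt_two).ne'
  simp only [Nat.card_prod, Nat.card_fun, card_nbrSet, Nat.card_zmod, Nat.card_fin,
    ← pow_add, Nat.cast_pow, Real.log_pow]
  push_cast [Nat.one_le_two_pow]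
  field_simp
  ring

end CompleteScheme

/-! ### Decoding -/

/-- Off-diagonal entries cancel in pairs under transposition. -/
lemma sum_sum_eq_zero_of_symm {ι : Type*} {v : ι → ι → ZMod 2} (hs : ∀ j l, v j l = v l j)
    (h0 : ∀ j, v j j = 0) (F : Finset ι) : ∑ j ∈ F, ∑ l ∈ F, v j l = 0 := by
  rw [← Finset.sum_product' F F v]
  refine Finset.sum_involution (fun x _ => x.swap) (fun x _ => ?_) (fun x _ hx => ?_)
    (fun x hx => ?_) fun x _ => x.swap_swap
  · rw [hs, Prod.fst_swap, Prod.snd_swap, CharTwo.add_self_eq_zero]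
  · rintro h
    have h' : x.2 = x.1 := congrArg Prod.fst h
    rw [h', h0] at hx
    exact hx rfl
  · simpa [and_comm] using hx

/-- Decoding a position that is read by the members of `F`: all rows inside `F` vanish, except that
in the row of `a` the missing column `b` is added. -/
lemma eq_zero_of_rows {ι : Type*} [DecidableEq ι] {v : ι → ι → ZMod 2} (hs : ∀ j l, v j l = v l j)
    (h0 : ∀ j, v j j = 0) {F : Finset ι} {a b : ι} (ha : a ∈ F) (hb : b ∉ F)
    (hrow : ∑ l ∈ insert b F, v a l = 0) (hrows : ∀ j ∈ F, j ≠ a → ∑ l ∈ F, v j l = 0) :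
    v a b = 0 := by
  have h := sum_sum_eq_zero_of_symm hs h0 F
  rw [Finset.sum_eq_single_of_mem a ha hrows] at h
  rwa [Finset.sum_insert hb, h, add_zero] at hrow

lemma sum_erase_self {ι : Type*} [DecidableEq ι] {v : ι → ι → ZMod 2} (h0 : ∀ j, v j j = 0)
    (F : Finset ι) (j : ι) : ∑ l ∈ F.erase j, v j l = ∑ l ∈ F, v j l :=
  Finset.sum_erase F (h0 j)

lemma univ_eq_insert_others (i i' : Fin N) :
    Finset.univ = insert i (insert i' (others i i')) := by
  ext x
  simp only [Finset.mem_univ, Finset.mem_insert, mem_others]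
  tauto

namespace Choices

variable {θ : (⊤ : SimpleGraph (Fin N)).edgeSet}

/-- For `F` in `famF`, the position of `φ F` is read by all members of `F`: each sums its row over
`F`, except that the endpoint of `θ` lying in `F` also includes the other endpoint. That extra entry
is the desired bit. -/
lemma σ_low_left (hN : 3 ≤ N) (c : Choices N θ) {F : Finset (Fin N)} (h : c.i ∈ F) (h' : c.i' ∉ F) :
    c.σ hN c.i ((insert c.i' F).erase c.i) = lowIndex hN (c.φ F) := by
  have hne := c.ne
  unfold σ
  rw [if_pos rfl, if_pos (by grind)]
  congr 2
  ext x; grind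

lemma σ_low_right (hN : 3 ≤ N) (c : Choices N θ) {F : Finset (Fin N)} (h : c.i ∉ F)
    (h' : c.i' ∈ F) : c.σ hN c.i' ((insert c.i F).erase c.i') = lowIndex hN (c.φ F) := by
  have hne := c.ne
  unfold σ
  rw [if_neg hne.symm, if_pos rfl, if_pos (by grind)]
  congr 2
  ext x; grind

lemma σ_low_other (hN : 3 ≤ N) (c : Choices N θ) {F : Finset (Fin N)} (hF : F ∈ famF c.i c.i')
    {j : Fin N} (hi : j ≠ c.i) (hi' : j ≠ c.i') (hj : j ∈ F) :
    c.σ hN j (F.erase j) = lowIndex hN (c.φ F) := by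
  have hF' : F.erase j ∈ famF c.i c.i' := by
    rw [mem_famF c.ne] at hF ⊢
    grind
  unfold σ
  rw [if_neg hi, if_neg hi', if_pos hF', Finset.insert_erase hj]

lemma σ_left (hN : 3 ≤ N) (c : Choices N θ) {P : Finset (Fin N)} (h' : c.i' ∉ P) :
    c.σ hN c.i P = highIndex hN (c.ψ s(P, others c.i c.i' \ P)) := by
  unfold σ
  rw [if_pos rfl, if_neg h']

lemma σ_right (hN : 3 ≤ N) (c : Choices N θ) {P : Finset (Fin N)} (h : c.i ∉ P) :
    c.σ hN c.i' P = midIndex hN (c.ψ s(P, others c.i c.i' \ P)) := by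
  unfold σ
  rw [if_neg c.ne.symm, if_pos rfl, if_neg h]

lemma σ_mid_other (hN : 3 ≤ N) (c : Choices N θ) {P : Finset (Fin N)} (h : P ⊆ others c.i c.i')
    {j : Fin N} (hj : j ∈ P) :
    c.σ hN j ((insert c.i (insert c.i' P)).erase j) =
      midIndex hN (c.ψ s(P, others c.i c.i' \ P)) := by
  have hj' := mem_others.1 (h hj)
  have hi : c.i ∉ P := fun hi => (mem_others.1 (h hi)).1 rfl
  have hi' : c.i' ∉ P := fun hi => (mem_others.1 (h hi)).2 rfl
  have hP : insert j ((insert c.i (insert c.i' P)).erase j \ {c.i, c.i'}) = P := by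
    ext x; grind
  unfold σ
  rw [if_neg hj'.1, if_neg hj'.2, if_neg (by rw [mem_famF c.ne]; grind), if_pos (by grind), hP]

/-- An index `k` belongs to both halves of its pair, so sums for `P` and for its complement are read
at the same position. -/
lemma exists_others_subset (c : Choices N θ) (k : Fin (2 ^ (N - 3))) :
    ∃ P ⊆ others c.i c.i', c.ψ s(P, others c.i c.i' \ P) = k ∧
      c.ψ s(others c.i c.i' \ P, others c.i c.i' \ (others c.i c.i' \ P)) = k := by
  obtain ⟨z, ⟨P, P', rfl, hd, hu⟩, hk⟩ := c.ψ_bij.surjOn (Set.mem_univ k)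
  have hP : P ⊆ others c.i c.i' := hu ▸ Finset.subset_union_left
  have hP' : others c.i c.i' \ P = P' := by
    rw [← hu, Finset.union_sdiff_left, Finset.sdiff_eq_self_of_disjoint hd.symm]
  refine ⟨P, hP, by rw [hP', hk], ?_⟩
  rw [Finset.sdiff_sdiff_eq_self hP, hP', Sym2.eq_swap, hk]

/-- The sums that are read at one position determine the bit of the desired file there. -/
lemma eq_zero_of_sums (hN : 3 ≤ N) (c : Choices N θ) (t : Fin (fileLength N))
    {v : Fin N → Fin N → ZMod 2} (hs : ∀ j l, v j l = v l j) (h0 : ∀ j, v j j = 0)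
    (hσ : ∀ j (P : Finset (Fin N)), j ∉ P → c.σ hN j P = t → ∑ l ∈ P, v j l = 0)
    (hτ : ∀ j k, c.τ hN j k = t → ∑ l, v j l = 0) : v c.i c.i' = 0 := by
  have hne := c.ne
  have ho : c.i ∉ others c.i c.i' := fun h => (mem_others.1 h).1 rfl
  have ho' : c.i' ∉ others c.i c.i' := fun h => (mem_others.1 h).2 rfl
  have hio : c.i ∉ insert c.i' (others c.i c.i') := by grind
  -- The diagonal vanishes, so rows may be summed over sets that contain `j` itself.
  have hσ' : ∀ j (P : Finset (Fin N)), c.σ hN j (P.erase j) = t → ∑ l ∈ P, v j l = 0 :=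
    fun j P h => sum_erase_self h0 P j ▸ hσ j _ (Finset.notMem_erase j P) h
  rcases index_cases hN t with ⟨s, rfl⟩ | ⟨k, rfl⟩ | ⟨k, rfl⟩
  · obtain ⟨F, hF, rfl⟩ := c.φ_bij.surjOn (Set.mem_univ s)
    have hF' := hF
    rw [mem_famF hne] at hF'
    by_cases hi : c.i ∈ F
    · have hi' : c.i' ∉ F := by tauto
      refine eq_zero_of_rows hs h0 hi hi' (hσ' _ _ (c.σ_low_left hN hi hi')) fun j hj hji => ?_
      exact hσ' _ _ (c.σ_low_other hN hF hji (fun h => hi' (h ▸ hj)) hj)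
    · have hi' : c.i' ∈ F := by tauto
      rw [hs]
      refine eq_zero_of_rows hs h0 hi' hi (hσ' _ _ (c.σ_low_right hN hi hi')) fun j hj hji => ?_
      exact hσ' _ _ (c.σ_low_other hN hF (fun h => hi (h ▸ hj)) hji hj)
  · obtain ⟨P, hP, hk, hk'⟩ := c.exists_others_subset k
    have hrow : ∀ P ⊆ others c.i c.i', c.ψ s(P, others c.i c.i' \ P) = k →
        ∑ l ∈ P, v c.i' l = 0 ∧ ∑ l ∈ P, v c.i l = 0 := by
      intro P hP hk
      have h₁ : ∑ l ∈ P, v c.i' l = 0 :=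
        hσ _ _ (fun h => ho' (hP h)) (by rw [c.σ_right hN fun h => ho (hP h), hk])
      -- Adding these rows over `j ∈ P` cancels the block `P × P`, so columns `i` and `i'` have
      -- equal sums over `P`. The second is known from the server `i'`.
      have h₂ : ∀ j ∈ P, v j c.i + (v j c.i' + ∑ l ∈ P, v j l) = 0 := by
        intro j hj
        have := hσ' _ _ ((c.σ_mid_other hN hP hj).trans (by rw [hk]))
        rwa [Finset.sum_insert (by grind), Finset.sum_insert (by grind)] at this
      have h₃ := Finset.sum_eq_zero h₂
      rw [Finset.sum_add_distrib, Finset.sum_add_distrib, sum_sum_eq_zero_of_symm hs h0,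
        add_zero] at h₃
      simp only [hs _ c.i, hs _ c.i'] at h₃
      rw [h₁, add_zero] at h₃
      exact ⟨h₁, h₃⟩
    have h₁ := (hrow P hP hk).2
    have h₂ := (hrow _ Finset.sdiff_subset hk').2
    -- In the full row of `i`, the parts over `P` and over its complement vanish, leaving only the
    -- desired entry.
    have h₃ := hτ c.i k (if_pos rfl)
    rw [univ_eq_insert_others c.i c.i', Finset.sum_insert hio, Finset.sum_insert ho',
      ← Finset.sum_sdiff hP, h₁, h₂, h0] at h₃
    simpa using h₃
  · obtain ⟨P, hP, hk, hk'⟩ := c.exists_others_subset k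
    have hrow : ∀ P ⊆ others c.i c.i', c.ψ s(P, others c.i c.i' \ P) = k →
        ∑ l ∈ P, v c.i l = 0 := by
      intro P hP hk
      exact hσ _ _ (fun h => ho (hP h)) (by rw [c.σ_left hN fun h => ho' (hP h), hk])
    have h₁ := hrow P hP hk
    have h₂ := hrow _ Finset.sdiff_subset hk'
    -- All full rows except that of `i` are downloaded here. The whole matrix sums to zero, so the
    -- full row of `i` vanishes as well.
    have h₃ := sum_sum_eq_zero_of_symm hs h0 Finset.univ
    rw [Finset.sum_eq_single_of_mem c.i (Finset.mem_univ _) fun j _ hj => hτ j k (if_neg hj),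
      univ_eq_insert_others c.i c.i', Finset.sum_insert hio, Finset.sum_insert ho',
      ← Finset.sum_sdiff hP, h₁, h₂, h0] at h₃
    simpa using h₃

/-- Every position of the desired file occurs in one of the sums. -/
lemma exists_pos_eq (hN : 3 ≤ N) (c : Choices N θ) (t : Fin (fileLength N)) :
    ∃ (j l : Fin N) (a : SumIndex j), s(j, l) = θ.1 ∧ a.Involves l ∧ c.pos hN a = t := by
  have hne := c.ne
  rcases index_cases hN t with ⟨s, rfl⟩ | ⟨k, rfl⟩ | ⟨k, rfl⟩
  · obtain ⟨F, hF, rfl⟩ := c.φ_bij.surjOn (Set.mem_univ s)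
    rw [mem_famF hne] at hF
    by_cases hi : c.i ∈ F
    · have hi' : c.i' ∉ F := by tauto
      have hm : c.i' ∈ (insert c.i' F).erase c.i := by grind
      exact ⟨c.i, c.i', .inl ⟨_, ⟨_, hm⟩, Finset.notMem_erase _ _⟩, c.eq_edge.symm, hm,
        c.σ_low_left hN hi hi'⟩
    · have hi' : c.i' ∈ F := by tauto
      have hm : c.i ∈ (insert c.i F).erase c.i' := by grind
      exact ⟨c.i', c.i, .inl ⟨_, ⟨_, hm⟩, Finset.notMem_erase _ _⟩,
        Sym2.eq_swap.trans c.eq_edge.symm, hm, c.σ_low_right hN hi hi'⟩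
  · exact ⟨c.i, c.i', .inr k, c.eq_edge.symm, hne.symm, if_pos rfl⟩
  · exact ⟨c.i', c.i, .inr k, Sym2.eq_swap.trans c.eq_edge.symm, hne, if_neg hne.symm⟩

end Choices

lemma completeScheme_reliable (hN : 3 ≤ N) (c : ∀ θ, Choices N θ) :
    (completeScheme N hN c).Reliable := by
  refine RetrievalScheme.reliable_of_determined _ fun θ => ?_
  rintro ⟨π, W⟩ ⟨π', W'⟩ hQ hA
  -- Equal queries need not give equal seeds, but every position of the desired file is read, so its
  -- permutation is revealed completely.
  have hpos : ∀ t, π θ t = π' θ t := by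
    intro t
    obtain ⟨j, l, a, hθ, ha, rfl⟩ := (c θ).exists_pos_eq hN t
    obtain rfl : file j l ha.ne = θ := Subtype.ext hθ
    cases a with
    | inl P => exact congrFun (congrFun (congrArg Prod.fst (hQ j)) P) ⟨l, ha⟩
    | inr k => exact congrFun (congrFun (congrArg Prod.snd (hQ j)) k) ⟨l, ha⟩
  suffices h : ∀ t, W θ (π θ t) = W' θ (π' θ t) by
    funext s
    have := h ((π θ).symm s)
    rwa [← hpos, Equiv.apply_symm_apply] at this
  intro t
  let v : Fin N → Fin N → ZMod 2 := fun j l =>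
    if h : l ≠ j then W (file j l h) (π (file j l h) t) - W' (file j l h) (π' (file j l h) t) else 0
  have hv : ∀ {j l} (h : l ≠ j), v j l =
      W (file j l h) (π (file j l h) t) - W' (file j l h) (π' (file j l h) t) := fun h => dif_pos h
  have h0 : ∀ j, v j j = 0 := fun j => dif_neg (by simp)
  have hs : ∀ j l, v j l = v l j := by
    intro j l
    by_cases h : l = j
    · rw [h]
    · rw [hv h, hv (Ne.symm h), file_symm]
  have key := (c θ).eq_zero_of_sums hN t hs h0 (fun j P hj hP => ?_) fun j k hk => ?_
  · rw [hv (c θ).ne.symm] at key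
    have : file (c θ).i (c θ).i' (c θ).ne.symm = θ := Subtype.ext (c θ).eq_edge.symm
    rw [this] at key
    exact sub_eq_zero.1 key
  -- No sum is asked for the empty set, which can be one half of a pair in `famG`; its row sum is
  -- trivially zero.
  · rcases P.eq_empty_or_nonempty with rfl | hne
    · exact Finset.sum_empty
    have h := congrFun (congrArg Prod.fst (hA j)) ⟨P, hne, hj⟩
    rw [← Finset.sum_coe_sort P]
    subst hP
    rw [← sub_eq_zero] at h
    refine Eq.trans ?_ h
    refine Eq.trans ?_ (Finset.sum_sub_distrib _ _)
    exact Finset.sum_congr rfl fun l _ => hv (NbrSet.ne_of_mem ⟨P, hne, hj⟩ l.2)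
  · have h := congrFun (congrArg Prod.snd (hA j)) k
    subst hk
    rw [← sub_eq_zero] at h
    have h1 : ∑ l, v j l = ∑ l : {l // l ≠ j}, v j l.1 := by
      rw [← sum_erase_self h0]
      exact Finset.sum_subtype _ (by simp) _
    rw [h1]
    refine Eq.trans ?_ h
    change _ = ∑ l : {l // l ≠ j}, W (file j l.1 l.2) (π (file j l.1 l.2) ((c θ).τ hN j k)) -
      ∑ l : {l // l ≠ j}, W' (file j l.1 l.2) (π' (file j l.1 l.2) ((c θ).τ hN j k))
    rw [← Finset.sum_sub_distrib]
    exact Finset.sum_congr rfl fun l _ => hv l.2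

lemma completeScheme_isPIR (hN : 3 ≤ N) (c : ∀ θ, Choices N θ) :
    (completeScheme N hN c).IsPIR :=
  ⟨completeScheme_reliable hN c, completeScheme_isPrivate hN c⟩

/-! ### Existence of the choices -/

lemma exists_bijOn_univ {α β : Type*} {n : ℕ} (hn : 0 < n) {S : Finset β} (hS : S.card = n)
    {s : Set α} {g : β → α} (hg : Set.BijOn g S s) : ∃ f : α → Fin n, Set.BijOn f s Set.univ := by
  classical
  let e : s ≃ Fin n := hg.equiv.symm.trans (S.equivFinOfCardEq hS)
  refine ⟨fun a => if h : a ∈ s then e ⟨a, h⟩ else ⟨0, hn⟩, fun a _ => Set.mem_univ _,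
    fun a ha b hb h => ?_, fun k _ => ⟨e.symm k, (e.symm k).2, ?_⟩⟩
  · simp only [dif_pos ha, dif_pos hb] at h
    exact congrArg Subtype.val (e.injective h)
  · simp

lemma exists_bijOn_famF {i i' : Fin N} (h : i ≠ i') :
    ∃ φ : Finset (Fin N) → Fin (2 ^ (N - 1)), Set.BijOn φ (famF i i') Set.univ := by
  -- A member of `famF` is determined by its part outside `i`: it contains `i` exactly when it omits
  -- `i'`.
  refine exists_bijOn_univ (S := (Finset.univ.erase i).powerset)
    (g := fun P => if i' ∈ P then P else insert i P) (by positivity) ?_ ⟨?_, ?_, ?_⟩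
  · rw [Finset.card_powerset, Finset.card_erase_of_mem (Finset.mem_univ _), Finset.card_univ,
      Fintype.card_fin]
  · intro P hP
    simp only [Finset.coe_powerset, Set.mem_preimage, Set.mem_powerset_iff, Finset.coe_subset,
      Finset.subset_erase] at hP
    rw [mem_famF h]
    grind
  · intro P hP P' hP' e
    simp only [Finset.coe_powerset, Set.mem_preimage, Set.mem_powerset_iff, Finset.coe_subset,
      Finset.subset_erase] at hP hP'
    ext x
    have := congrArg (x ∈ ·) e
    have := congrArg (i' ∈ ·) e
    grind
  · intro P hP
    rw [mem_famF h] at hP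
    refine ⟨P.erase i, by simp, ?_⟩
    ext x
    grind

lemma exists_bijOn_famG (hN : 3 ≤ N) {i i' : Fin N} (h : i ≠ i') :
    ∃ ψ : Sym2 (Finset (Fin N)) → Fin (2 ^ (N - 3)), Set.BijOn ψ (famG i i') Set.univ := by
  have hc : (others i i').card = N - 2 := by
    rw [others, Finset.card_sdiff_of_subset (Finset.subset_univ _), Finset.card_univ,
      Fintype.card_fin, Finset.card_pair h]
  -- Each unordered pair is represented by its half that avoids `m`.
  obtain ⟨m, hm⟩ : (others i i').Nonempty := Finset.card_pos.1 (by omega)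
  have hmem : ∀ {P : Finset (Fin N)}, P ∈ (((others i i').erase m).powerset : Set _) ↔
      P ⊆ others i i' ∧ m ∉ P := by
    intro P
    rw [Finset.mem_coe, Finset.mem_powerset, Finset.subset_erase]
  refine exists_bijOn_univ (S := ((others i i').erase m).powerset)
    (g := fun P => s(P, others i i' \ P)) (by positivity) ?_ ⟨?_, ?_, ?_⟩
  · rw [Finset.card_powerset, Finset.card_erase_of_mem hm, hc, Nat.sub_sub]
  · intro P hP
    exact ⟨P, _, rfl, Finset.disjoint_sdiff, Finset.union_sdiff_of_subset (hmem.1 hP).1⟩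
  · intro P hP P' hP' e
    rcases Sym2.eq_iff.1 e with e | e
    · exact e.1
    · refine absurd ?_ (hmem.1 hP).2
      rw [e.1]
      exact Finset.mem_sdiff.2 ⟨hm, (hmem.1 hP').2⟩
  · rintro _ ⟨P, P', rfl, hd, hu⟩
    have hd' := Finset.disjoint_left.1 hd
    have key : ∀ Q Q' : Finset (Fin N), Disjoint Q Q' → Q ∪ Q' = others i i' → m ∉ Q →
        s(Q, Q') ∈ (fun P => s(P, others i i' \ P)) ''
          (((others i i').erase m).powerset : Set (Finset (Fin N))) := by
      intro Q Q' hd hu hQ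
      refine ⟨Q, hmem.2 ⟨hu ▸ Finset.subset_union_left, hQ⟩, ?_⟩
      simp only [← hu, Finset.union_sdiff_left, Finset.sdiff_eq_self_of_disjoint hd.symm]
    by_cases hmP : m ∈ P
    · rw [Sym2.eq_swap]
      exact key P' P hd.symm (by rw [Finset.union_comm, hu]) (hd' hmP)
    · exact key P P' hd hu hmP

lemma nonempty_choices (hN : 3 ≤ N) (θ : (⊤ : SimpleGraph (Fin N)).edgeSet) :
    Nonempty (Choices N θ) := by
  obtain ⟨⟨i, i'⟩, hθ⟩ := θ
  have h : i ≠ i' := by simpa using hθ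
  obtain ⟨φ, hφ⟩ := exists_bijOn_famF h
  obtain ⟨ψ, hψ⟩ := exists_bijOn_famG hN h
  have hF : ∀ {j P}, P ∈ restSets i i' j → insert i P ∈ famF i i' := by
    rintro j P ⟨-, -, hi, hi'⟩
    rw [mem_famF h]
    grind
  -- The set `insert i P` omits `j`, whereas the sets `insert j R` already used by the server `j`
  -- contain it.
  refine ⟨⟨i, i', rfl, φ, hφ, ψ, hψ, fun _ P => φ (insert i P), ?_, ?_⟩⟩
  · intro j _ _ P hP P' hP' e
    have := hφ.injOn (hF hP) (hF hP') e
    rw [← Finset.erase_insert hP.2.2.1, this, Finset.erase_insert hP'.2.2.1]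
  · intro j hj hj' P hP R hR hjR e
    have hR' : insert j R ∈ famF i i' := by
      rw [mem_famF h] at hR ⊢
      grind
    have := hφ.injOn (hF hP) hR' e
    have hjP := hP.2.1
    have : j ∈ insert i P := this ▸ Finset.mem_insert_self j R
    grind

/-! ### Entropy inequalities for functions of independent uniform variables -/

section FunctionsOfUniform

variable {α β γ : Type*} [Finite α] [Finite β] [Finite γ]

lemma ent_eq_avg {α : Type*} (p : PMF α) :
    ent p = avg p fun x => -Real.log (p x).toReal := by
  simp only [ent, avg, Real.negMulLog, neg_mul, mul_neg]

lemma ent_map_le (p : PMF α) (g : α → β) : ent (p.map g) ≤ ent p := by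
  rw [ent_eq_avg, ent_eq_avg p, avg_map]
  refine avg_mono p fun a ha => neg_le_neg ?_
  refine Real.log_le_log (ENNReal.toReal_pos ha (p.apply_ne_top a)) ?_
  refine ENNReal.toReal_mono ((p.map g).apply_ne_top _) ?_
  classical
  rw [PMF.map_apply]
  exact (if_pos rfl).symm.le.trans (ENNReal.le_tsum (f := fun x => if g a = g x then p x else 0) a)

variable {F : Type*} [Finite F] [Nonempty F]

lemma ent_uniform_prod_map (f : F → α) (g : F → β) :
    ent ((uniform (F × F)).map fun x => (f x.1, g x.2)) =
      ent ((uniform F).map f) + ent ((uniform F).map g) := by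
  rw [← avg_const ((uniform F).map f) (ent ((uniform F).map g)), ← ent_bind_pair,
    ← indepProd_uniform, indepProd, PMF.map_bind, PMF.bind_map]
  congr 2
  funext a
  rw [PMF.map_comp, Function.comp_apply, PMF.map_comp]
  rfl

/-- If the answers `f₁ a b`, `f₂ a c`, `f₃ b c` determine `a`, then their entropies add up to at
least `H(a) + H(f₁ | a) + H(f₂ | a)`. -/
lemma log_card_add_avg_add_avg_le {f₁ : F → F → α} {f₂ : F → F → β} {f₃ : F → F → γ}
    (h : ∀ a b c a' b' c', f₁ a b = f₁ a' b' → f₂ a c = f₂ a' c' → f₃ b c = f₃ b' c' → a = a') :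
    Real.log (Nat.card F) + avg (uniform F) (fun a => ent ((uniform F).map (f₁ a))) +
        avg (uniform F) (fun a => ent ((uniform F).map (f₂ a))) ≤
      ent ((uniform (F × F × F)).map fun x => f₁ x.1 x.2.1) +
        ent ((uniform (F × F × F)).map fun x => f₂ x.1 x.2.2) +
        ent ((uniform (F × F × F)).map fun x => f₃ x.2.1 x.2.2) := by
  set Y : F × F × F → α × β × γ := fun x => (f₁ x.1 x.2.1, f₂ x.1 x.2.2, f₃ x.2.1 x.2.2) with hY
  have hfac : Function.FactorsThrough (fun x : F × F × F => x.1) Y := by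
    intro x x' e
    simp only [hY, Prod.mk.injEq] at e
    exact h _ _ _ _ _ _ e.1 e.2.1 e.2.2
  obtain ⟨g, hg⟩ := (Function.factorsThrough_iff _).1 hfac
  have hXY : (fun x => (x.1, Y x)) = (fun y => (g y, y)) ∘ Y := by
    funext x
    exact Prod.ext (congrFun hg x) rfl
  have e₁ : ent ((uniform (F × F × F)).map Y) =
      ent ((uniform (F × F × F)).map fun x => (x.1, Y x)) := by
    rw [hXY, ← PMF.map_comp,
      ent_map_of_injective (f := fun y => (g y, y)) fun a b hab => (Prod.mk.inj hab).2]
  have e₂ : ent ((uniform (F × F × F)).map fun x => (x.1, Y x)) = Real.log (Nat.card F) +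
      avg (uniform F) fun a => ent ((uniform (F × F)).map fun y => Y (a, y)) := by
    rw [← ent_uniform, ← ent_bind_pair, ← indepProd_uniform, indepProd, PMF.map_bind]
    congr 2
    funext a
    rw [PMF.map_comp, PMF.map_comp]
    rfl
  -- For fixed `a`, the first two answers depend on the independent variables `b` and `c`, so their
  -- entropies add; the third answer is dropped.
  have e₃ : ∀ a, ent ((uniform F).map (f₁ a)) + ent ((uniform F).map (f₂ a)) ≤
      ent ((uniform (F × F)).map fun y => Y (a, y)) := by
    intro a
    rw [← ent_uniform_prod_map]
    refine le_trans (le_of_eq ?_) (ent_map_le _ fun y => (y.1, y.2.1))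
    rw [PMF.map_comp]
    rfl
  have e₄ := avg_mono (uniform F) fun a _ => e₃ a
  rw [avg_add] at e₄
  have e₅ := ent_map_pair_le (uniform (F × F × F)) (fun x => f₁ x.1 x.2.1)
    fun x => (f₂ x.1 x.2.2, f₃ x.2.1 x.2.2)
  have e₆ := ent_map_pair_le (uniform (F × F × F)) (fun x => f₂ x.1 x.2.2)
    fun x => f₃ x.2.1 x.2.2
  linarith

/-- If `g₁ b a` and `g₂ c a` determine `a` for all `b`, `c`, then
`H(a) ≤ H(g₁ | b) + H(g₂ | c)`. -/
lemma log_card_le_avg_add_avg {g₁ : F → F → α} {g₂ : F → F → β}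
    (h : ∀ b c a a', g₁ b a = g₁ b a' → g₂ c a = g₂ c a' → a = a') :
    Real.log (Nat.card F) ≤ avg (uniform F) (fun b => ent ((uniform F).map (g₁ b))) +
      avg (uniform F) (fun c => ent ((uniform F).map (g₂ c))) := by
  have key : ∀ b c, Real.log (Nat.card F) ≤
      ent ((uniform F).map (g₁ b)) + ent ((uniform F).map (g₂ c)) := by
    intro b c
    rw [← ent_uniform, ← ent_map_of_injective (f := fun a => (g₁ b a, g₂ c a)) (fun a a' e =>
      h b c a a' (Prod.mk.inj e).1 (Prod.mk.inj e).2) (uniform F)]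
    exact ent_map_pair_le _ _ _
  have key' : ∀ b, Real.log (Nat.card F) ≤
      ent ((uniform F).map (g₁ b)) + avg (uniform F) fun c => ent ((uniform F).map (g₂ c)) := by
    intro b
    have := avg_mono (uniform F) fun c _ => key b c
    rwa [avg_add, avg_const, avg_const] at this
  have := avg_mono (uniform F) fun b _ => key' b
  rwa [avg_add, avg_const, avg_const] at this

end FunctionsOfUniform

/-! ### General properties of PIR schemes -/

namespace RetrievalScheme

variable {V : Type} [Finite V] {G : SimpleGraph V} {L : ℕ} (T : RetrievalScheme G L)

/-- The joint law of all queries. -/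
def queryLaw (θ : G.edgeSet) : PMF (∀ v, T.Query v) := T.seedLaw.map (T.query θ)

variable {T}

lemma mem_support_law {s : T.Seed} (hs : s ∈ T.seedLaw.support) (W : Files G L) :
    (s, W) ∈ T.law.support := by
  rw [law, indepProd, PMF.mem_support_bind_iff]
  refine ⟨s, hs, ?_⟩
  rw [PMF.mem_support_map_iff]
  exact ⟨W, mem_support_uniform W, rfl⟩

/-- Every database has positive probability together with every seed in the support, so zero
conditional entropy becomes exact decodability for each fixed tuple of possible queries. -/
lemma Reliable.determined (h : T.Reliable) {θ : G.edgeSet} {q : ∀ v, T.Query v}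
    (hq : q ∈ (T.queryLaw θ).support) {W W' : Files G L}
    (hW : ∀ v, T.answer v (q v) (stored W v) = T.answer v (q v) (stored W' v)) : W θ = W' θ := by
  rw [queryLaw, PMF.mem_support_map_iff] at hq
  obtain ⟨s, hs, rfl⟩ := hq
  have hθ := h θ
  rw [condEntropy, entropy_eq_ent, entropy_eq_ent, sub_eq_zero,
    div_left_inj' (Real.log_pos one_lt_two).ne'] at hθ
  set Y : T.Seed × Files G L → _ := fun ω => (fun v => T.A θ v ω, fun v => T.Q θ v ω) with hY
  have hYeq : Y (s, W) = Y (s, W') := Prod.ext (funext hW) rfl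
  refine eq_of_ent_eq_ent_snd (p := T.law.map fun ω => (ω.2 θ, Y ω)) (b := Y (s, W)) ?_ ?_ ?_
  · rw [hθ, PMF.map_comp]
    rfl
  · rw [PMF.mem_support_map_iff]
    exact ⟨(s, W), mem_support_law hs W, rfl⟩
  · rw [PMF.mem_support_map_iff]
    exact ⟨(s, W'), mem_support_law hs W', by rw [hYeq]⟩

lemma map_Q (θ : G.edgeSet) (v : V) : T.law.map (T.Q θ v) = (T.queryLaw θ).map fun q => q v := by
  have := T.law_map (fun s => T.query θ s v) fun q _ => q
  refine this.trans ?_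
  have hc : ∀ x : T.Query v, (uniform (Files G L)).map (fun _ => x) = PMF.pure x := fun x =>
    PMF.map_const _ x
  simp only [hc, PMF.bind_pure]
  rw [queryLaw, PMF.map_comp]
  rfl

lemma IsPrivate.queryLaw_map (h : T.IsPrivate) (v : V) (θ θ' : G.edgeSet) :
    ((T.queryLaw θ).map fun q => q v) = (T.queryLaw θ').map fun q => q v := by
  have := congrArg (PMF.map Prod.fst) (h v θ θ')
  rw [PMF.map_comp, PMF.map_comp] at this
  rw [← map_Q, ← map_Q]
  exact this

lemma IsPrivate.map_A (h : T.IsPrivate) (v : V) (θ θ' : G.edgeSet) :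
    T.law.map (T.A θ v) = T.law.map (T.A θ' v) := by
  have := congrArg (PMF.map fun x => x.2.1) (h v θ θ')
  rw [PMF.map_comp, PMF.map_comp] at this
  exact this

lemma IsPrivate.avg_queryLaw (h : T.IsPrivate) (v : V) (f : T.Query v → ℝ) (θ θ' : G.edgeSet) :
    avg (T.queryLaw θ) (fun q => f (q v)) = avg (T.queryLaw θ') fun q => f (q v) := by
  have := congrArg (fun p => avg p f) (h.queryLaw_map v θ θ')
  simp only [avg_map] at this
  exact this

/-- Conditioning on the queries reduces the entropy of an answer. -/
lemma avg_ent_answer_le (θ : G.edgeSet) (v : V) :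
    avg (T.queryLaw θ) (fun q => ent ((uniform (Files G L)).map
      fun W => T.answer v (q v) (stored W v))) ≤ ent (T.law.map (T.A θ v)) := by
  have := T.law_map (T.query θ) fun q W => T.answer v (q v) (stored W v)
  refine (avg_ent_le_ent_bind _ _).trans (le_of_eq ?_)
  exact congrArg ent this.symm

end RetrievalScheme

/-! ### The converse for the triangle -/

section Triangle

variable {L : ℕ} {u v w : Fin 3}

/-- The files stored on `u`, when the one shared with `v` is `a` and the other one is `b`. -/
def pairFiles (u v : Fin 3) (a b : Fin L → ZMod 2) :
    StoredFiles (⊤ : SimpleGraph (Fin 3)) L u :=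
  fun e => if v ∈ e.1.1 then a else b

lemma stored_eq_pairFiles (huv : v ≠ u) (huw : w ≠ u) (hvw : w ≠ v)
    (W : Files (⊤ : SimpleGraph (Fin 3)) L) :
    stored W u = pairFiles u v (W (file u v huv)) (W (file u w huw)) := by
  funext ⟨⟨e, he⟩, hu⟩
  obtain ⟨x, (rfl : e = s(u, x))⟩ := hu
  have hx : u ≠ x := by simpa using he
  simp only [stored, pairFiles, Sym2.mem_iff, huv, false_or]
  split_ifs with h
  · subst h; rfl
  · obtain rfl : x = w := by omega
    rfl

lemma edge_cases (huv : v ≠ u) (huw : w ≠ u) (hvw : w ≠ v)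
    (e : (⊤ : SimpleGraph (Fin 3)).edgeSet) :
    e = file u v huv ∨ e = file u w huw ∨ e = file v w hvw := by
  obtain ⟨⟨x, y⟩, he⟩ := e
  have hx : x ≠ y := by simpa using he
  simp only [file, Subtype.mk.injEq, Sym2.eq_iff]
  omega

lemma uniform_files_map (huv : v ≠ u) (huw : w ≠ u) (hvw : w ≠ v) :
    (uniform (Files (⊤ : SimpleGraph (Fin 3)) L)).map
        (fun W => (W (file u v huv), W (file u w huw), W (file v w hvw))) =
      uniform ((Fin L → ZMod 2) × (Fin L → ZMod 2) × (Fin L → ZMod 2)) := by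
  refine uniform_map_equiv (Equiv.ofBijective _ ⟨fun W W' h => ?_, fun x => ?_⟩)
  · simp only [Prod.mk.injEq] at h
    funext e
    rcases edge_cases huv huw hvw e with rfl | rfl | rfl
    exacts [h.1, h.2.1, h.2.2]
  · obtain ⟨a, b, c⟩ := x
    have h₁ : file u w huw ≠ file u v huv := fun h => hvw (file_inj h)
    have h₂ : file v w hvw ≠ file u v huv := fun h => huw (file_inj (h.trans (file_symm _ _ _)))
    have h₃ : file v w hvw ≠ file u w huw := fun h =>
      huv (file_inj (((file_symm _ _ _).symm.trans h).trans (file_symm _ _ _)))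
    exact ⟨fun e => if e = file u v huv then a else if e = file u w huw then b else c, by
      simp [h₁, h₂, h₃]⟩

variable {T : RetrievalScheme (⊤ : SimpleGraph (Fin 3)) L}

/-- The entropy of the answer of `u`, given the queries and the file shared with `v`. -/
def answerEnt (T : RetrievalScheme (⊤ : SimpleGraph (Fin 3)) L)
    (θ : (⊤ : SimpleGraph (Fin 3)).edgeSet) (u v : Fin 3) : ℝ :=
  avg (T.queryLaw θ) fun q => avg (uniform (Fin L → ZMod 2)) fun a =>
    ent ((uniform (Fin L → ZMod 2)).map fun b => T.answer u (q u) (pairFiles u v a b))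

/-- Only the query to `u` enters, and by privacy its law is the same for all desired files. -/
lemma answerEnt_eq (hT : T.IsPrivate) (θ θ' : (⊤ : SimpleGraph (Fin 3)).edgeSet) (u v : Fin 3) :
    answerEnt T θ u v = answerEnt T θ' u v :=
  hT.avg_queryLaw u (fun q => avg (uniform (Fin L → ZMod 2)) fun a =>
    ent ((uniform (Fin L → ZMod 2)).map fun b => T.answer u q (pairFiles u v a b))) θ θ'

lemma log_card_fin_fun : Real.log (Nat.card (Fin L → ZMod 2)) = L * Real.log 2 := by
  simp

lemma exists_files (huv : v ≠ u) (huw : w ≠ u) (hvw : w ≠ v) (a b c : Fin L → ZMod 2) :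
    ∃ W : Files (⊤ : SimpleGraph (Fin 3)) L,
      W (file u v huv) = a ∧ W (file u w huw) = b ∧ W (file v w hvw) = c := by
  have h := mem_support_uniform (a, b, c)
  rw [← uniform_files_map huv huw hvw, PMF.mem_support_map_iff] at h
  obtain ⟨W, -, hW⟩ := h
  exact ⟨W, by simpa using hW⟩

lemma determined_of_pairFiles (hT : T.Reliable) (huv : v ≠ u) (huw : w ≠ u) (hvw : w ≠ v)
    {q : ∀ v, T.Query v} (hq : q ∈ (T.queryLaw (file u v huv)).support)
    {a b c a' b' c' : Fin L → ZMod 2}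
    (hu : T.answer u (q u) (pairFiles u v a b) = T.answer u (q u) (pairFiles u v a' b'))
    (hv : T.answer v (q v) (pairFiles v u a c) = T.answer v (q v) (pairFiles v u a' c'))
    (hw : T.answer w (q w) (pairFiles w u b c) = T.answer w (q w) (pairFiles w u b' c')) :
    a = a' := by
  obtain ⟨W, rfl, rfl, rfl⟩ := exists_files huv huw hvw a b c
  obtain ⟨W', rfl, rfl, rfl⟩ := exists_files huv huw hvw a' b' c'
  refine hT.determined hq fun x => ?_
  have hx : x = u ∨ x = v ∨ x = w := by omega
  rcases hx with rfl | rfl | rfl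
  · simpa only [stored_eq_pairFiles huv huw hvw] using hu
  · simpa only [stored_eq_pairFiles huv.symm hvw huw, file_symm x u] using hv
  · simpa only [stored_eq_pairFiles huw.symm hvw.symm huv, file_symm x u, file_symm x v] using hw

lemma pairFiles_comm (huv : v ≠ u) (huw : w ≠ u) (hvw : w ≠ v) (a b : Fin L → ZMod 2) :
    pairFiles u v a b = pairFiles u w b a := by
  obtain ⟨W, rfl, rfl, -⟩ := exists_files huv huw hvw a b 0
  rw [← stored_eq_pairFiles huv huw hvw, ← stored_eq_pairFiles huw huv hvw.symm]

lemma add_answerEnt_le (hT : T.Reliable) (huv : v ≠ u) (huw : w ≠ u) (hvw : w ≠ v) :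
    L * Real.log 2 + answerEnt T (file u v huv) u v + answerEnt T (file u v huv) v u ≤
      ent (T.law.map (T.A (file u v huv) u)) + ent (T.law.map (T.A (file u v huv) v)) +
        ent (T.law.map (T.A (file u v huv) w)) := by
  have key := avg_mono (T.queryLaw (file u v huv)) fun q hq => log_card_add_avg_add_avg_le
    (f₁ := fun a b => T.answer u (q u) (pairFiles u v a b))
    (f₂ := fun a c => T.answer v (q v) (pairFiles v u a c))
    (f₃ := fun b c => T.answer w (q w) (pairFiles w u b c))
    fun a b c a' b' c' h₁ h₂ h₃ => determined_of_pairFiles hT huv huw hvw hq h₁ h₂ h₃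
  simp only [avg_add, avg_const, log_card_fin_fun, ← uniform_files_map huv huw hvw,
    PMF.map_comp] at key
  refine key.trans (add_le_add (add_le_add ?_ ?_) ?_)
  · refine le_trans (le_of_eq ?_) (RetrievalScheme.avg_ent_answer_le _ u)
    simp only [stored_eq_pairFiles huv huw hvw]
    rfl
  · refine le_trans (le_of_eq ?_) (RetrievalScheme.avg_ent_answer_le _ v)
    simp only [stored_eq_pairFiles huv.symm hvw huw, file_symm v u]
    rfl
  · refine le_trans (le_of_eq ?_) (RetrievalScheme.avg_ent_answer_le _ w)
    simp only [stored_eq_pairFiles huw.symm hvw.symm huv, file_symm w u, file_symm w v]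
    rfl

lemma le_answerEnt_add (hT : T.Reliable) (huv : v ≠ u) (huw : w ≠ u) (hvw : w ≠ v) :
    L * Real.log 2 ≤ answerEnt T (file u v huv) u w + answerEnt T (file u v huv) v w := by
  have key := avg_mono (T.queryLaw (file u v huv)) fun q hq => log_card_le_avg_add_avg
    (g₁ := fun b a => T.answer u (q u) (pairFiles u w b a))
    (g₂ := fun c a => T.answer v (q v) (pairFiles v w c a))
    -- With `b` and `c` fixed, the answer of `w` carries no information on `a`.
    fun b c a a' h₁ h₂ => determined_of_pairFiles (b := b) (c := c) (b' := b) (c' := c)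
      hT huv huw hvw hq
      (by simpa only [pairFiles_comm huv huw hvw] using h₁)
      (by simpa only [pairFiles_comm huv.symm hvw huw] using h₂) rfl
  simp only [avg_add, avg_const, log_card_fin_fun] at key
  exact key

lemma rate_triangle_le (hT : T.IsPIR) (θ : (⊤ : SimpleGraph (Fin 3)).edgeSet) :
    T.rate θ ≤ 1 / 2 := by
  obtain ⟨hr, hp⟩ := hT
  have h01 : (1 : Fin 3) ≠ 0 := by decide
  have h02 : (2 : Fin 3) ≠ 0 := by decide
  have h12 : (2 : Fin 3) ≠ 1 := by decide
  have a₁ := add_answerEnt_le hr h01 h02 h12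
  have a₂ := add_answerEnt_le hr h02 h01 h12.symm
  have a₃ := add_answerEnt_le hr h12 h01.symm h02.symm
  have b₁ := le_answerEnt_add hr h01 h02 h12
  have b₂ := le_answerEnt_add hr h02 h01 h12.symm
  have b₃ := le_answerEnt_add hr h12 h01.symm h02.symm
  -- Privacy rewrites all six inequalities in terms of one desired file, so that they can be added.
  simp only [answerEnt_eq hp _ θ, hp.map_A _ _ θ] at a₁ a₂ a₃ b₁ b₂ b₃
  have hlog := Real.log_pos one_lt_two
  rw [RetrievalScheme.rate, finsum_eq_sum_of_fintype, Fin.sum_univ_three]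
  simp only [entropy_eq_ent]
  rw [← add_div, ← add_div]
  refine div_le_of_le_mul₀ ?_ (by norm_num) ?_
  · have := fun v => ent_nonneg (T.law.map (T.A θ v))
    exact div_nonneg (add_nonneg (add_nonneg (this 0) (this 1)) (this 2)) hlog.le
  · rw [mul_div_assoc', le_div_iff₀ hlog]
    linarith

end Triangle

/-! ### The rate of the complete scheme -/

lemma rate_completeScheme {N : ℕ} (hN : 3 ≤ N) (c : ∀ θ, Choices N θ)
    (θ : (⊤ : SimpleGraph (Fin N)).edgeSet) :
    (completeScheme N hN c).rate θ =
      (3 * 2 ^ (N - 2) : ℝ) / (2 ^ (N - 1) + 2 ^ (N - 3) - 1) * (1 / N) := by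
  rw [RetrievalScheme.rate, finsum_eq_sum_of_fintype]
  simp only [entropy_completeScheme_A, Finset.sum_const, Finset.card_univ, Fintype.card_fin,
    nsmul_eq_mul]
  rw [fileLength, div_mul_div_comm, mul_one, mul_comm (N : ℝ)]
  push_cast
  rfl

lemma isPIRCapacity_triangle {R : ℝ} (hR : R = 1 / 2)
    (h : R ∈ achievableRates (⊤ : SimpleGraph (Fin 3))) :
    IsPIRCapacity (⊤ : SimpleGraph (Fin 3)) R := by
  refine ⟨?_, fun _ hb => hb h⟩
  rintro _ ⟨L, -, T, hT, θ, rfl⟩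
  exact hR ▸ rate_triangle_le hT θ

end GraphPIR
end

/-! ### Assembly and comparison of the rates -/

theorem mainTheorem5 (N : ℕ) (hN : 3 ≤ N) :
    (∀ θ, Nonempty (GraphPIR.Choices N θ)) ∧
    ∀ c : ∀ θ, GraphPIR.Choices N θ,
      (GraphPIR.completeScheme N hN c).IsPIR ∧
      ∀ θ, ∀ R : ℝ, R = (GraphPIR.completeScheme N hN c).rate θ →
        R = (3 * 2 ^ (N - 2) : ℝ) / (2 ^ (N - 1) + 2 ^ (N - 3) - 1) * (1 / N) ∧
        R = 6 / (5 - (2 : ℝ) ^ (3 - (N : ℤ))) * (1 / N) ∧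
        (N = 3 → R = 1 / 2 ∧ GraphPIR.IsPIRCapacity (⊤ : SimpleGraph (Fin N)) R) ∧
        (4 ≤ N → (2 : ℝ) ^ (N - 1) / (2 ^ (N - 1) - 1) * (1 / N) < R) ∧
        (N = 4 → 3 / 10 < R) := by
  refine ⟨GraphPIR.nonempty_choices hN, fun c => ?_⟩
  have hpir := GraphPIR.completeScheme_isPIR hN c
  refine ⟨hpir, fun θ R hR => ?_⟩
  have hR' := hR.trans (GraphPIR.rate_completeScheme hN c θ)
  refine ⟨hR', ?_, ?_, ?_, ?_⟩
  · rw [hR']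
    obtain ⟨n, rfl⟩ := Nat.exists_eq_add_of_le' hN
    have h1 : (1 : ℝ) ≤ 2 ^ n := one_le_pow₀ one_le_two
    have hz : (2 : ℝ) ^ (3 - ((n + 3 : ℕ) : ℤ)) = (2 ^ n)⁻¹ := by
      rw [show 3 - ((n + 3 : ℕ) : ℤ) = -(n : ℤ) by push_cast; ring, zpow_neg, zpow_natCast]
    rw [hz, show n + 3 - 1 = n + 2 by omega, show n + 3 - 2 = n + 1 by omega,
      Nat.add_sub_cancel, pow_add, pow_add]
    congr 1
    have h2 : (2 : ℝ) ^ n * 2 ^ 2 + 2 ^ n - 1 = 2 ^ n * (5 - (2 ^ n)⁻¹) := by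
      field_simp
      ring
    rw [h2, show (3 : ℝ) * (2 ^ n * 2 ^ 1) = 2 ^ n * 6 by ring,
      mul_div_mul_left _ _ (by positivity)]
  · rintro rfl
    have h2 : R = 1 / 2 := by
      rw [hR']
      norm_num
    exact ⟨h2, GraphPIR.isPIRCapacity_triangle h2
      ⟨GraphPIR.fileLength 3, by norm_num [GraphPIR.fileLength], _, hpir, θ, hR⟩⟩
  · intro h4
    rw [hR']
    obtain ⟨n, rfl⟩ := Nat.exists_eq_add_of_le' h4
    have h1 : (1 : ℝ) ≤ 2 ^ n := one_le_pow₀ one_le_two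
    rw [show n + 4 - 1 = n + 3 by omega, show n + 4 - 2 = n + 2 by omega,
      show n + 4 - 3 = n + 1 by omega, pow_add, pow_add, pow_add]
    refine mul_lt_mul_of_pos_right ?_ (by positivity)
    rw [div_lt_div_iff₀ (by linarith) (by linarith)]
    -- With `x = 2 ^ n` the inequality reduces to `4 * x < 16 * x ^ 2`, which holds as `1 ≤ x`.
    nlinarith
  · rintro rfl
    rw [hR']
    norm_num
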